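/- Let $e_1=-1-3\sqrt2$, $H=\frac1{\sqrt2}\begin{pmatrix}1&1\\1&-1\end{pmatrix}$, $T=\mathrm{diag}(1,e^{i\pi/4})$ and $|\omega\rangle=\frac1{\sqrt8}\sum_{j=0}^7e^{-i\pi j/4}|j\rangle$. Put $$|\psi_{z,0}\rangle=\tfrac1{\sqrt8}\bigl(|z\rangle(|1\rangle+|3\rangle+|5\rangle+|7\rangle)+H|z\rangle(|2\rangle+|8\rangle)+HT|z\rangle(|4\rangle+|6\rangle)\bigr)|\omega\rangle,\qquad |\psi_{z,1}\rangle=|\psi_{z,0}\rangle^*\qquad(z\in\{0,1\}).$$ Consider simple graphs $g$ on the 128 vertices $(z,t,j)$, $z\in\{0,1\}$, $t\in\{1,\dots,8\}$, $j\in\{0,\dots,7\}$, with the property (P) the smallest eigenvalue of the adjacency matrix $A(g)$ is $e_1$, and its eigenspace is the span of $|\psi_{z,a}\rangle$, $z,a\in\{0,1\}$. One such graph is $g_0$, defined as follows. Let $U_1=U_2=U_7=U_8=H$, $U_3=U_5=HT$, $U_4=U_6=(HT)^\dagger$; every entry of $-\sqrt2\,U_t$ is a power $e^{i\pi k/4}$.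 Let $S$ be the cyclic shift $|j\rangle\mapsto|j+1\bmod 8\rangle$ and let $B_t$ be obtained from $-\sqrt2\,U_t$ by replacing each entry $e^{i\pi k/4}$ by $S^k$. Then $A(g_0)=\sum_{t=1}^8\bigl(B_t\otimes|t+1\rangle\langle t|+\text{h.c.}\bigr)+1\otimes1\otimes(S^3+S^4+S^5)$, where $|9\rangle=|1\rangle$ and $B_t$ acts on the registers $z$ and $j$. *Gate graphs.* A gate diagram consists of $R$ diagram elements, each labelled $1$, $H$ or $HT$, a set $\mathcal S$ of nodes (self-loops) and a set $\mathcal E$ of unordered pairs of distinct nodes (edges). The nodes of the $q$-th element, $q\in\{1,\dots,R\}$, are the triples $(q,z,t)$ with $z\in\{0,1\}$ and $t\in\{1,3,5,7\}$, $\{1,3,2,8\}$ or $\{1,3,4,6\}$ for label $1$, $H$, $HT$ respectively. Each node has at most one incident edge or self-loop, and never both. For $g$ with (P), the associated gate graph $G$ has vertices $(q,z,t,j)$ and adjacency matrix $$A(G)=1_q\otimes A(g)+\sum_{n\in\mathcal S}|n\rangle\langle n|\otimes1_j+\sum_{\{n,n'\}\in\mathcal E}(|n\rangle+|n'\rangle)(\langle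 n|+\langle n'|)\otimes1_j .$$ $G$ is an $e_1$-gate graph if the smallest eigenvalue of $A(G)$ is $e_1$. Let $\mathcal N$ be the set of vertices $(q,z,t,j)$ such that $(q,z,t)$ is not in $\mathcal S$ and lies on no edge of $\mathcal E$, let $\Pi_{\mathcal N}=\sum_{v\in\mathcal N}|v\rangle\langle v|$ and $\Pi_+=\frac12(|0\rangle+|1\rangle)(\langle0|+\langle1|)$, and define the graph $G^{\mathrm{SL}}$, on two copies of the vertex set of $G$, by $$A(G^{\mathrm{SL}})=A(G)\otimes1+2\,\Pi_{\mathcal N}\otimes\Pi_+ .$$ For a matrix $M$ let $\gamma(M)$ denote its smallest nonzero eigenvalue. **Lemma.** The graph $g_0$ has property (P). There is an absolute constant $C>0$ such that for every $g$ with property (P) (in particular for $g=g_0$), every $R$ and every gate diagram with $R$ elements whose gate graph $G$ is an $e_1$-gate graph, $A(G)-e_1$ and $A(G^{\mathrm{SL}})-e_1$ have nonzero eigenvalues and $$\gamma\bigl(A(G^{\mathrm{SL}})-e_1\bigr)\ \ge\ C\,\gamma\bigl(A(G)-e_1\bigr).$$ -/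

import Mathlib

open scoped Kronecker ComplexConjugate

namespace GateGraph

noncomputable section

/-! ### Eigenvalues -/

/-- The real eigenvalues of a complex square matrix (all its eigenvalues, if it is Hermitian). -/
def eigenvalueSet {n : Type*} [Fintype n] [DecidableEq n] (A : Matrix n n ℂ) : Set ℝ :=
  {μ | Module.End.HasEigenvalue (Matrix.toLin' A) (μ : ℂ)}

/-- `c` is the smallest nonzero eigenvalue `γ(A)` of `A`; in particular a nonzero eigenvalue
exists. -/
def IsSmallestNonzeroEigenvalue {n : Type*} [Fintype n] [DecidableEq n]
    (A : Matrix n n ℂ) (c : ℝ) : Prop :=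
  IsLeast (eigenvalueSet A \ {0}) c

/-- `e₁ = -1 - 3√2`. -/
def e1 : ℝ := -1 - 3 * √2

/-! ### The graph `g₀` -/

/-- The labels `(z, t, j)` of the 128 vertices of `g₀`. The label `t ∈ {1, …, 8}` is represented
by its residue modulo 8 in `Fin 8` (so `t = 8` is the numeral `8 = 0`), and `j ∈ {0, …, 7}`. -/
abbrev Vertex0 : Type := Fin 2 × Fin 8 × Fin 8

/-- The Hadamard gate. -/
def gateH : Matrix (Fin 2) (Fin 2) ℂ := ((1 / √2 : ℝ) : ℂ) • !![1, 1; 1, -1]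

/-- The `T` gate `diag(1, e^{iπ/4})`. -/
def gateT : Matrix (Fin 2) (Fin 2) ℂ := !![1, 0; 0, Complex.exp (Complex.I * Real.pi / 4)]

/-- The unitary applied to the first register at `t`: `H` for `t = 2, 8`, `HT` for `t = 4, 6`, and
the identity for `t = 1, 3, 5, 7`. -/
def stepUnitary (t : Fin 8) : Matrix (Fin 2) (Fin 2) ℂ :=
  if t = 2 ∨ t = 8 then gateH else if t = 4 ∨ t = 6 then gateH * gateT else 1

/-- The state `|ω⟩ = 8^{-1/2} ∑ⱼ e^{-iπj/4} |j⟩`. -/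
def omegaState (j : Fin 8) : ℂ :=
  ((1 / √8 : ℝ) : ℂ) * Complex.exp (-(Complex.I * Real.pi / 4 * ((j : ℕ) : ℂ)))

/-- The states `|ψ_{z,0}⟩` and `|ψ_{z,1}⟩ = |ψ_{z,0}⟩^*`. -/
def psi (z a : Fin 2) : Vertex0 → ℂ := fun v =>
  let w : ℂ := ((1 / √8 : ℝ) : ℂ) * stepUnitary v.2.1 v.1 z * omegaState v.2.2
  if a = 0 then w else conj w

/-- The spectral description of `g₀`: the smallest eigenvalue of its adjacency matrix is `e₁`, and
the corresponding eigenspace is spanned by the four (orthonormal) states `|ψ_{z,a}⟩`. -/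
structure HasG0Spectrum (g : SimpleGraph Vertex0) [DecidableRel g.Adj] : Prop where
  isLeast_e1 : IsLeast (eigenvalueSet (g.adjMatrix ℂ)) e1
  eigenspace_e1 : Module.End.eigenspace (Matrix.toLin' (g.adjMatrix ℂ)) (e1 : ℂ) =
    Submodule.span ℂ (Set.range fun za : Fin 2 × Fin 2 => psi za.1 za.2)

/-- Exponents of the hopping terms of `g₀`. Let `U_t` be the gate leading from `t` to `t + 1` in
the cyclic sequence `1, H, 1, HT, 1, HT, 1, H` (for `t = 1, …, 8`), that is
`U_t = H` for `t = 1, 2, 7, 8`, `U_t = HT` for `t = 3, 5`, `U_t = (HT)†` for `t = 4, 6`.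
Then `(-√2 U_t)_{x,z} = e^{iπk/4}` with `k = hopExponent t x z`. -/
def hopExponent (t : Fin 8) (x z : Fin 2) : Fin 8 :=
  if t = 3 ∨ t = 5 then !![4, 5; 4, 1] x z
  else if t = 4 ∨ t = 6 then !![4, 4; 3, 7] x z
  else !![4, 4; 4, 0] x z

/-- The graph `g₀`. With `S` the cyclic shift `|j⟩ ↦ |j + 1⟩`, its adjacency matrix is obtained
from `-√2 ∑ₜ (U_t ⊗ |t + 1⟩⟨t| + h.c.)` by replacing each nonzero entry `e^{iπk/4}` by `S^k`, and
adding `S³ + S⁴ + S⁵` on the third register. -/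
def g0 : SimpleGraph Vertex0 :=
  SimpleGraph.fromRel fun u v =>
    (v.2.1 = u.2.1 + 1 ∧ v.2.2 = u.2.2 + hopExponent u.2.1 v.1 u.1) ∨
    (v.1 = u.1 ∧ v.2.1 = u.2.1 ∧ (v.2.2 = u.2.2 + 3 ∨ v.2.2 = u.2.2 + 4))

instance : DecidableRel g0.Adj := fun u v =>
  inferInstanceAs (Decidable ((SimpleGraph.fromRel _).Adj u v))

/-! ### Gate diagrams and gate graphs -/

/-- The unitary labels `1`, `H`, `HT` of diagram elements. -/
inductive ElementLabel : Type
  | one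
  | H
  | HT

/-- The values of `t` for which the nodes `(z, t)` appear in a diagram element. -/
def ElementLabel.times : ElementLabel → Finset (Fin 8)
  | .one => {1, 3, 5, 7}
  | .H => {1, 3, 2, 8}
  | .HT => {1, 3, 4, 6}

/-- Node labels `(q, z, t)`. -/
abbrev Node (R : ℕ) : Type := Fin R × Fin 2 × Fin 8

/-- Vertices `(q, z, t, j)` of a gate graph. -/
abbrev Vertex (R : ℕ) : Type := Fin R × Vertex0

/-- A gate diagram with `R` diagram elements: a unitary label for each element, a set `S` of nodes
with self-loops and a set `E` of edges (unordered pairs of distinct nodes). Each node has at most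
one incident edge or self-loop, and never both. -/
structure GateDiagram (R : ℕ) where
  label : Fin R → ElementLabel
  S : Finset (Node R)
  E : Finset (Sym2 (Node R))
  mem_times_of_mem_S : ∀ n ∈ S, n.2.2 ∈ (label n.1).times
  mem_times_of_mem_E : ∀ e ∈ E, ∀ n ∈ e, n.2.2 ∈ (label n.1).times
  not_isDiag : ∀ e ∈ E, ¬ e.IsDiag
  not_mem_E_of_mem_S : ∀ n ∈ S, ∀ e ∈ E, n ∉ e
  edge_unique : ∀ e ∈ E, ∀ e' ∈ E, ∀ n, n ∈ e → n ∈ e' → e = e'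

/-- The node `(q, z, t)` of a vertex `(q, z, t, j)`. -/
def Vertex.node {R : ℕ} (v : Vertex R) : Node R := (v.1, v.2.1, v.2.2.1)

/-- The operator `|x⟩⟨x| ⊗ 1_j`, for a real vector `x` indexed by nodes. -/
def nodeOperator {R : ℕ} (x : Node R → ℂ) : Matrix (Vertex R) (Vertex R) ℂ :=
  (Matrix.vecMulVec x x ⊗ₖ (1 : Matrix (Fin 8) (Fin 8) ℂ)).submatrix
    (fun v => (Vertex.node v, v.2.2.2)) (fun v => (Vertex.node v, v.2.2.2))

namespace GateDiagram

variable {R : ℕ} (D : GateDiagram R)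

/-- `h_S = ∑_{n ∈ S} |n⟩⟨n| ⊗ 1_j`. -/
def hS : Matrix (Vertex R) (Vertex R) ℂ :=
  ∑ n ∈ D.S, nodeOperator (Pi.single n 1)

/-- `h_E = ∑_{{n, n'} ∈ E} (|n⟩ + |n'⟩)(⟨n| + ⟨n'|) ⊗ 1_j`. -/
def hE : Matrix (Vertex R) (Vertex R) ℂ :=
  ∑ e ∈ D.E, nodeOperator (fun n => if n ∈ e then 1 else 0)

/-- The adjacency matrix `A(G) = 1_q ⊗ A(g) + h_S + h_E` of the gate graph of the diagram `D`
built on the graph `g`. -/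
def adj (g : SimpleGraph Vertex0) [DecidableRel g.Adj] : Matrix (Vertex R) (Vertex R) ℂ :=
  (1 : Matrix (Fin R) (Fin R) ℂ) ⊗ₖ g.adjMatrix ℂ + D.hS + D.hE

/-- The gate graph is an `e₁`-gate graph: the smallest eigenvalue of `A(G)` is `e₁`. -/
def IsE1GateGraph (g : SimpleGraph Vertex0) [DecidableRel g.Adj] : Prop :=
  IsLeast (eigenvalueSet (D.adj g)) e1

/-- The set `𝒩` of vertices without self-loops in the gate graph. -/
def noLoop : Set (Vertex R) :=
  {v | Vertex.node v ∉ D.S ∧ ∀ n' : Node R, s(Vertex.node v, n') ∉ D.E}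

open Classical in
/-- The projector `Π_𝒩`. -/
def projNoLoop : Matrix (Vertex R) (Vertex R) ℂ :=
  Matrix.diagonal fun v => if v ∈ D.noLoop then 1 else 0

/-- The adjacency matrix `A(G^SL) = A(G) ⊗ 1_d + 2 Π_𝒩 ⊗ Π_+`, where
`Π_+ = ½ (|0⟩ + |1⟩)(⟨0| + ⟨1|)`. -/
def adjSL (g : SimpleGraph Vertex0) [DecidableRel g.Adj] :
    Matrix (Vertex R × Fin 2) (Vertex R × Fin 2) ℂ :=
  D.adj g ⊗ₖ (1 : Matrix (Fin 2) (Fin 2) ℂ) +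
    (2 : ℂ) • (D.projNoLoop ⊗ₖ ((1 / 2 : ℂ) • !![1, 1; 1, 1]))

end GateDiagram

end

end GateGraph

/-!
`A(G) - e₁` is positive semidefinite, and so is each of the three summands `1 ⊗ (A(g) - e₁)`, `h_S`
and `h_E`. A vector of its kernel therefore restricts, on each diagram element, to a combination of
the `ψ_{z,a}`, whose weight is spread evenly over the eight times. One time of each element carries
no node, so `2 Π_𝒩` has expectation at least `1/4` on the kernel.

Since `Π_+` is a projection, the spectrum of `A(G^SL)` is the union of those of `A(G)` and
`A(G) + 2 Π_𝒩`. If `S, T ≥ 0`, the nonzero eigenvalues of `S` are at least `d`, and `T ≤ β` has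
expectation at least `c` on the kernel of `S`, then `S + T ≥ c d / (c + d + β)`. With `c = 1/4`,
`β = 2` and the bound `γ(A(G) - e₁) ≤ 7`, given by a test vector, this yields the constant `1/37`.

The matrix `A(g₀)` commutes with translations of the third register, so it splits over the
characters of `ℤ/8`. At the character `e^{iπj/4}` conjugation by the accumulated unitaries of the
computation (which close up around the cycle) turns it into `-√2` times the adjacency matrix of the
cycle of length 8, minus `1 + √2`: the smallest eigenvalue is `e₁`, attained on the constant
vectors. The conjugate character behaves in the same way. For the other six, the loop term is at
least `-1` and the hopping terms have norm at most `4`, which keeps every eigenvalue above `e₁`.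
-/

namespace GateGraph

open Matrix
open scoped ComplexOrder InnerProductSpace

/-! ### Positive operators and their kernels -/

section InnerProductSpace

variable {𝕜 E : Type*} [RCLike 𝕜] [NormedAddCommGroup E] [InnerProductSpace 𝕜 E]

lemma exists_hasEigenvalue_le_of_mem_orthogonal_ker [FiniteDimensional 𝕜 E] {T : E →ₗ[𝕜] E}
    (hT : T.IsSymmetric) {x : E} (hx : x ∈ T.kerᗮ) (hx₀ : x ≠ 0) :
    ∃ μ : ℝ, Module.End.HasEigenvalue T (μ : 𝕜) ∧ μ ≠ 0 ∧
      μ * ‖x‖ ^ 2 ≤ RCLike.re ⟪T x, x⟫_𝕜 := by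
  set b := hT.eigenvectorBasis rfl
  set ev := hT.eigenvalues rfl
  have norm_sq : ‖x‖ ^ 2 = ∑ i, ‖b.repr x i‖ ^ 2 := by
    rw [← b.repr.norm_map, EuclideanSpace.norm_sq_eq]
  have rayleigh : RCLike.re ⟪T x, x⟫_𝕜 = ∑ i, ev i * ‖b.repr x i‖ ^ 2 := by
    rw [← b.repr.inner_map_map, PiLp.inner_apply, map_sum]
    refine Finset.sum_congr rfl fun i _ => ?_
    rw [hT.eigenvectorBasis_apply_self_apply, RCLike.inner_apply, map_mul (starRingEnd 𝕜),
      RCLike.conj_ofReal, mul_left_comm, RCLike.mul_conj, RCLike.re_ofReal_mul]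
    norm_cast
  have repr_eq_zero (i) (hi : ev i = 0) : b.repr x i = 0 := by
    rw [b.repr_apply_apply]
    refine hx _ ?_
    simp [b, hT.apply_eigenvectorBasis, show hT.eigenvalues rfl i = 0 from hi]
  obtain ⟨j, hj⟩ : ∃ j, b.repr x j ≠ 0 := by
    by_contra! h
    exact hx₀ (b.repr.map_eq_zero_iff.1 (by ext i; exact h i))
  obtain ⟨i, hi, hle⟩ : ∃ i ∈ Finset.univ.filter (b.repr x · ≠ 0),
      ev i * ‖b.repr x i‖ ^ 2 * ‖x‖ ^ 2 ≤ RCLike.re ⟪T x, x⟫_𝕜 * ‖b.repr x i‖ ^ 2 := by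
    refine Finset.exists_le_of_sum_le ⟨j, by simpa using hj⟩ (le_of_eq ?_)
    rw [Finset.sum_filter_of_ne, Finset.sum_filter_of_ne, ← Finset.sum_mul, ← Finset.mul_sum,
      ← norm_sq, ← rayleigh]
    all_goals intro i _; contrapose!; intro h; simp [h]
  have hi' : b.repr x i ≠ 0 := by simpa using hi
  refine ⟨ev i, hT.hasEigenvalue_eigenvalues rfl i, fun h => hi' (repr_eq_zero i h), ?_⟩
  have := pow_pos (norm_pos_iff.2 hi') 2
  nlinarith

lemma mul_norm_sq_le_of_mem_orthogonal_ker [FiniteDimensional 𝕜 E] {T : E →ₗ[𝕜] E}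
    (hT : T.IsSymmetric) {d : ℝ}
    (hd : ∀ μ : ℝ, Module.End.HasEigenvalue T (μ : 𝕜) → μ ≠ 0 → d ≤ μ)
    {x : E} (hx : x ∈ T.kerᗮ) : d * ‖x‖ ^ 2 ≤ RCLike.re ⟪T x, x⟫_𝕜 := by
  rcases eq_or_ne x 0 with rfl | hx₀
  · simp
  obtain ⟨μ, hμ, hμ₀, hle⟩ := exists_hasEigenvalue_le_of_mem_orthogonal_ker hT hx hx₀
  exact (mul_le_mul_of_nonneg_right (hd μ hμ hμ₀) (sq_nonneg _)).trans hle

lemma re_inner_map_smul_add_smul {T : E →ₗ[𝕜] E} (hT : T.IsSymmetric) (a b : ℝ) (u v : E) :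
    RCLike.re ⟪T ((a : 𝕜) • u + (b : 𝕜) • v), (a : 𝕜) • u + (b : 𝕜) • v⟫_𝕜 =
      a ^ 2 * RCLike.re ⟪T u, u⟫_𝕜 + 2 * a * b * RCLike.re ⟪T u, v⟫_𝕜 +
        b ^ 2 * RCLike.re ⟪T v, v⟫_𝕜 := by
  have symm : RCLike.re ⟪T v, u⟫_𝕜 = RCLike.re ⟪T u, v⟫_𝕜 := by
    rw [hT, ← inner_conj_symm, RCLike.conj_re]
  simp only [map_add, map_smul, inner_add_left, inner_add_right, inner_smul_left,
    inner_smul_right, RCLike.conj_ofReal, RCLike.re_ofReal_mul, symm]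
  ring

lemma re_inner_map_le_of_add {T : E →ₗ[𝕜] E} (hT : T.IsPositive) (a b : ℝ) (u v : E) :
    a * b * RCLike.re ⟪T u, u⟫_𝕜 ≤
      (a + b) * (a * RCLike.re ⟪T (u + v), u + v⟫_𝕜 + b * RCLike.re ⟪T v, v⟫_𝕜) := by
  have nonneg := hT.re_inner_nonneg_left ((a : 𝕜) • u + ((a + b : ℝ) : 𝕜) • v)
  have expand := re_inner_map_smul_add_smul hT.isSymmetric 1 1 u v
  rw [re_inner_map_smul_add_smul hT.isSymmetric] at nonneg
  simp only [RCLike.ofReal_one, one_smul] at expand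
  rw [expand]
  linarith

lemma le_re_inner_add_of_isPositive {S T : E →ₗ[𝕜] E} [S.ker.HasOrthogonalProjection]
    (hS : S.IsSymmetric) (hT : T.IsPositive) {c d β : ℝ} (hc : 0 < c) (hd : 0 ≤ d)
    (hSd : ∀ y ∈ S.kerᗮ, d * ‖y‖ ^ 2 ≤ RCLike.re ⟪S y, y⟫_𝕜)
    (hTc : ∀ k ∈ S.ker, c * ‖k‖ ^ 2 ≤ RCLike.re ⟪T k, k⟫_𝕜)
    (hTβ : ∀ x, RCLike.re ⟪T x, x⟫_𝕜 ≤ β * ‖x‖ ^ 2) (x : E) :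
    c * d / (c + d + β) * ‖x‖ ^ 2 ≤ RCLike.re ⟪(S + T) x, x⟫_𝕜 := by
  rcases eq_or_ne x 0 with rfl | hx
  · simp
  have hβ : 0 ≤ β := by
    have h := (hT.re_inner_nonneg_left x).trans (hTβ x)
    exact nonneg_of_mul_nonneg_left h (pow_pos (norm_pos_iff.2 hx) 2)
  obtain ⟨k, hk, y, hy, rfl⟩ := S.ker.exists_add_mem_mem_orthogonal x
  have norm_sq : ‖k + y‖ ^ 2 = ‖k‖ ^ 2 + ‖y‖ ^ 2 := by
    simpa only [sq] using norm_add_sq_eq_norm_sq_add_norm_sq_of_inner_eq_zero k y (hy k hk)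
  have inner_S : RCLike.re ⟪S (k + y), k + y⟫_𝕜 = RCLike.re ⟪S y, y⟫_𝕜 := by
    rw [map_add, LinearMap.mem_ker.1 hk, zero_add, inner_add_right, hS, LinearMap.mem_ker.1 hk,
      inner_zero_right, zero_add]
  have hTky := re_inner_map_le_of_add hT (c + β) d k y
  have hSy := hSd y hy
  have hTk := hTc k hk
  have hTy := hTβ y
  rw [LinearMap.add_apply, inner_add_left, map_add, inner_S, norm_sq, div_mul_eq_mul_div,
    div_le_iff₀ (by positivity)]
  refine le_of_mul_le_mul_left ?_ (show 0 < c + β by positivity)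
  calc (c + β) * (c * d * (‖k‖ ^ 2 + ‖y‖ ^ 2))
      ≤ (c + β) * d * RCLike.re ⟪T k, k⟫_𝕜 + (c + β) * c * (d * ‖y‖ ^ 2) := by
        have := mul_le_mul_of_nonneg_left hTk (show 0 ≤ (c + β) * d by positivity)
        linarith
    _ ≤ (c + β + d) * ((c + β) * RCLike.re ⟪T (k + y), k + y⟫_𝕜 + d * (β * ‖y‖ ^ 2)) +
        (c + β) * c * (d * ‖y‖ ^ 2) := by
        have : (c + β + d) * (d * RCLike.re ⟪T y, y⟫_𝕜) ≤
            (c + β + d) * (d * (β * ‖y‖ ^ 2)) := by gcongr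
        linarith
    _ = (c + β + d) * (c + β) * RCLike.re ⟪T (k + y), k + y⟫_𝕜 +
        ((c + β) * (c + d + β) - c * d) * (d * ‖y‖ ^ 2) := by ring
    _ ≤ (c + β + d) * (c + β) * RCLike.re ⟪T (k + y), k + y⟫_𝕜 +
        ((c + β) * (c + d + β)) * RCLike.re ⟪S y, y⟫_𝕜 := by
        have := mul_nonneg (mul_nonneg hc.le hd) (mul_nonneg hd (sq_nonneg ‖y‖))
        have := mul_le_mul_of_nonneg_left hSy (show 0 ≤ (c + β) * (c + d + β) by positivity)
        linarith
    _ = _ := by ring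

end InnerProductSpace

section EigenvalueSet

variable {n : Type*} [Fintype n]

lemma mulVec_eq_zero_of_posSemidef_add {A B : Matrix n n ℂ} (hA : A.PosSemidef)
    (hB : B.PosSemidef) {x : n → ℂ} (h : (A + B) *ᵥ x = 0) : A *ᵥ x = 0 := by
  rw [← hA.dotProduct_mulVec_zero_iff]
  have sum_eq_zero : star x ⬝ᵥ A *ᵥ x + star x ⬝ᵥ B *ᵥ x = 0 := by
    rw [← dotProduct_add, ← add_mulVec, h, dotProduct_zero]
  exact ((add_eq_zero_iff_of_nonneg (hA.dotProduct_mulVec_nonneg x)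
    (hB.dotProduct_mulVec_nonneg x)).1 sum_eq_zero).1

variable [DecidableEq n]

lemma mem_eigenvalueSet_iff {A : Matrix n n ℂ} {μ : ℝ} :
    μ ∈ eigenvalueSet A ↔ ∃ x : n → ℂ, x ≠ 0 ∧ A *ᵥ x = (μ : ℂ) • x := by
  constructor
  · intro h
    obtain ⟨x, hx⟩ := Module.End.HasEigenvalue.exists_hasEigenvector h
    exact ⟨x, hx.2, by simpa using hx.apply_eq_smul⟩
  · rintro ⟨x, hx, h⟩
    exact Module.End.hasEigenvalue_of_hasEigenvector
      ⟨Module.End.mem_eigenspace_iff.2 (by simpa using h), hx⟩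

lemma mem_eigenvalueSet_sub_iff {A : Matrix n n ℂ} {μ c : ℝ} :
    μ ∈ eigenvalueSet (A - (c : ℂ) • 1) ↔ μ + c ∈ eigenvalueSet A := by
  simp only [mem_eigenvalueSet_iff, sub_mulVec, smul_mulVec, one_mulVec, sub_eq_iff_eq_add,
    Complex.ofReal_add, add_smul]

lemma exists_isSmallestNonzeroEigenvalue {A : Matrix n n ℂ}
    (h : (eigenvalueSet A \ {0}).Nonempty) : ∃ γ, IsSmallestNonzeroEigenvalue A γ :=
  have finite : (eigenvalueSet A).Finite :=
    (Module.End.finite_hasEigenvalue (toLin' A)).preimage Complex.ofReal_injective.injOn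
  finite.sdiff.isCompact.exists_isLeast h

lemma posSemidef_sub_of_isLeast {A : Matrix n n ℂ} {c : ℝ} (hA : A.IsHermitian)
    (h : IsLeast (eigenvalueSet A) c) : (A - (c : ℂ) • 1).PosSemidef := by
  have hAc : (A - (c : ℂ) • 1).IsHermitian := hA.sub (by simp [IsHermitian, conjTranspose_smul])
  refine hAc.posSemidef_iff_eigenvalues_nonneg.2 fun i => ?_
  have mem : hAc.eigenvalues i ∈ eigenvalueSet (A - (c : ℂ) • 1) := by
    refine mem_eigenvalueSet_iff.2 ⟨_, fun h₀ => ?_, hAc.mulVec_eigenvectorBasis i⟩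
    exact hAc.eigenvectorBasis.toBasis.ne_zero i (by ext j; simpa using congrFun h₀ j)
  simpa using h.2 (mem_eigenvalueSet_sub_iff.1 mem)

lemma mem_ker_toEuclideanLin_iff {A : Matrix n n ℂ} {x : EuclideanSpace ℂ n} :
    x ∈ (toEuclideanLin A).ker ↔ A *ᵥ x.ofLp = 0 := by
  rw [LinearMap.mem_ker, ← WithLp.ofLp_eq_zero 2, ofLp_toLpLin, toLin'_apply]

lemma mem_eigenvalueSet_iff_hasEigenvalue_toEuclideanLin {A : Matrix n n ℂ} {μ : ℝ} :
    μ ∈ eigenvalueSet A ↔ Module.End.HasEigenvalue (toEuclideanLin A) (μ : ℂ) := by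
  rw [eigenvalueSet, Set.mem_ofPred_eq, Module.End.hasEigenvalue_iff_mem_spectrum,
    Module.End.hasEigenvalue_iff_mem_spectrum, spectrum_toLin', spectrum_toLpLin]

lemma nonneg_of_mem_eigenvalueSet {A : Matrix n n ℂ} (hA : A.PosSemidef) {μ : ℝ}
    (hμ : μ ∈ eigenvalueSet A) : 0 ≤ μ := by
  rw [mem_eigenvalueSet_iff_hasEigenvalue_toEuclideanLin] at hμ
  refine eigenvalue_nonneg_of_nonneg hμ ?_
  exact (isPositive_toEuclideanLin_iff.2 hA).re_inner_nonneg_right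

lemma re_inner_toEuclideanLin (A : Matrix n n ℂ) (x : EuclideanSpace ℂ n) :
    (⟪toEuclideanLin A x, x⟫_ℂ).re = (star x.ofLp ⬝ᵥ A *ᵥ x.ofLp).re := by
  rw [← inner_conj_symm, Complex.conj_re, EuclideanSpace.inner_eq_star_dotProduct,
    dotProduct_comm, ofLp_toLpLin, toLin'_apply]

lemma re_inner_toEuclideanLin_diagonal (w : n → ℝ) (x : EuclideanSpace ℂ n) :
    (⟪toEuclideanLin (diagonal fun i => (w i : ℂ)) x, x⟫_ℂ).re = ∑ i, w i * ‖x i‖ ^ 2 := by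
  rw [re_inner_toEuclideanLin]
  simp only [dotProduct, mulVec_diagonal, Complex.re_sum, Pi.star_apply, RCLike.star_def,
    mul_left_comm, Complex.conj_mul']
  norm_cast

lemma exists_mem_eigenvalueSet_diff_zero_le {A : Matrix n n ℂ} (hA : A.IsHermitian) {x : n → ℂ}
    (hx : ∀ k, A *ᵥ k = 0 → star k ⬝ᵥ x = 0) (hx₀ : x ≠ 0) :
    ∃ μ ∈ eigenvalueSet A \ {0}, μ * ∑ i, ‖x i‖ ^ 2 ≤ (star x ⬝ᵥ A *ᵥ x).re := by
  have mem : WithLp.toLp 2 x ∈ (toEuclideanLin A).kerᗮ := fun k hk => by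
    rw [EuclideanSpace.inner_eq_star_dotProduct, dotProduct_comm]
    exact hx _ (mem_ker_toEuclideanLin_iff.1 hk)
  obtain ⟨μ, hμ, hμ₀, hle⟩ := exists_hasEigenvalue_le_of_mem_orthogonal_ker
    (isSymmetric_toEuclideanLin_iff.2 hA) mem (by simpa using hx₀)
  refine ⟨μ, ⟨mem_eigenvalueSet_iff_hasEigenvalue_toEuclideanLin.2 hμ, hμ₀⟩, ?_⟩
  rwa [RCLike.re_eq_complex_re, re_inner_toEuclideanLin, EuclideanSpace.norm_sq_eq] at hle

lemma exists_mem_eigenvalueSet_two_mul_le {A : Matrix n n ℂ} (hA : A.IsHermitian) {v w : n}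
    (hvw : v ≠ w) (hker : ∀ k, A *ᵥ k = 0 → k v + k w = 0) :
    ∃ μ ∈ eigenvalueSet A \ {0}, 2 * μ ≤ (A v v + A v w + (A w v + A w w)).re := by
  set x : n → ℂ := Pi.single v 1 + Pi.single w 1 with hx
  have dot (y : n → ℂ) : y ⬝ᵥ x = y v + y w := by simp [hx, dotProduct_add]
  have star_x : star x = x := by rw [hx, star_add, ← Pi.single_star, ← Pi.single_star, star_one]
  have x_v : x v = 1 := by simp [hx, hvw]
  have x_w : x w = 1 := by simp [hx, hvw.symm]
  have norm_sq : ∑ i, ‖x i‖ ^ 2 = 2 := by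
    have : ((∑ i, ‖x i‖ ^ 2 : ℝ) : ℂ) = star x ⬝ᵥ x := by simp [dotProduct, Complex.conj_mul']
    rw [star_x, dot, x_v, x_w] at this
    exact_mod_cast this.trans one_add_one_eq_two
  obtain ⟨μ, hμ, hle⟩ := exists_mem_eigenvalueSet_diff_zero_le hA (x := x)
    (fun k hk => by rw [dot, Pi.star_apply, Pi.star_apply, ← star_add, hker k hk, star_zero])
    fun h => one_ne_zero (x_v.symm.trans (congrFun h _))
  refine ⟨μ, hμ, ?_⟩
  rw [norm_sq, star_x, dotProduct_comm, dot, mulVec, mulVec, dot, dot] at hle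
  linarith

lemma le_of_mem_eigenvalueSet_add_diagonal {A : Matrix n n ℂ} (hA : A.IsHermitian) {w : n → ℝ}
    {c d β μ : ℝ} (hc : 0 < c) (hd : 0 ≤ d) (hAd : d ∈ lowerBounds (eigenvalueSet A \ {0}))
    (hw : 0 ≤ w) (hwβ : ∀ i, w i ≤ β)
    (hwc : ∀ k, A *ᵥ k = 0 → c * ∑ i, ‖k i‖ ^ 2 ≤ ∑ i, w i * ‖k i‖ ^ 2)
    (hμ : μ ∈ eigenvalueSet (A + diagonal fun i => (w i : ℂ))) :
    c * d / (c + d + β) ≤ μ := by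
  have hA' := isSymmetric_toEuclideanLin_iff.2 hA
  have isPositive : (toEuclideanLin (diagonal fun i => (w i : ℂ))).IsPositive :=
    isPositive_toEuclideanLin_iff.2
      (PosSemidef.diagonal fun i => by simpa using hw i)
  obtain ⟨x, hx⟩ := Module.End.HasEigenvalue.exists_hasEigenvector
    (mem_eigenvalueSet_iff_hasEigenvalue_toEuclideanLin.1 hμ)
  have key : c * d / (c + d + β) * ‖x‖ ^ 2 ≤
      RCLike.re ⟪(toEuclideanLin A + toEuclideanLin (diagonal fun i => (w i : ℂ))) x, x⟫_ℂ := by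
    refine le_re_inner_add_of_isPositive hA' isPositive hc hd (fun y hy => ?_) (fun k hk => ?_)
      (fun x => ?_) x
    · refine mul_norm_sq_le_of_mem_orthogonal_ker hA' (fun ν hν hν₀ => ?_) hy
      exact hAd ⟨mem_eigenvalueSet_iff_hasEigenvalue_toEuclideanLin.2 hν, hν₀⟩
    · rw [RCLike.re_eq_complex_re, re_inner_toEuclideanLin_diagonal, EuclideanSpace.norm_sq_eq]
      exact hwc _ (mem_ker_toEuclideanLin_iff.1 hk)
    · rw [RCLike.re_eq_complex_re, re_inner_toEuclideanLin_diagonal, EuclideanSpace.norm_sq_eq,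
        Finset.mul_sum]
      exact Finset.sum_le_sum fun i _ => mul_le_mul_of_nonneg_right (hwβ i) (sq_nonneg _)
  rw [← map_add, hx.apply_eq_smul, inner_smul_left, Complex.conj_ofReal,
    RCLike.re_eq_complex_re, Complex.re_ofReal_mul, inner_self_eq_norm_sq_to_K] at key
  norm_cast at key
  exact le_of_mul_le_mul_right key (pow_pos (norm_pos_iff.2 hx.2) 2)

end EigenvalueSet

/-! ### Kronecker products with a projection -/

section Kronecker

variable {m n : Type*} [Fintype m] [Fintype n]

lemma kronecker_mulVec_prod (A : Matrix m m ℂ) (P : Matrix n n ℂ) (x : m → ℂ) (u : n → ℂ) :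
    (A ⊗ₖ P) *ᵥ (fun p => x p.1 * u p.2) = fun p => (A *ᵥ x) p.1 * (P *ᵥ u) p.2 := by
  ext p
  simp [mulVec, dotProduct, Fintype.sum_prod_type, Finset.sum_mul_sum, mul_mul_mul_comm]

lemma kronecker_one_mulVec_apply [DecidableEq n]
    (A : Matrix m m ℂ) (x : m × n → ℂ) (i : m) (j : n) :
    ((A ⊗ₖ (1 : Matrix n n ℂ)) *ᵥ x) (i, j) = (A *ᵥ fun i' => x (i', j)) i := by
  simp [mulVec, dotProduct, Fintype.sum_prod_type, kroneckerMap_apply, one_apply]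

lemma one_kronecker_mulVec_apply [DecidableEq m]
    (A : Matrix n n ℂ) (x : m × n → ℂ) (i : m) (j : n) :
    (((1 : Matrix m m ℂ) ⊗ₖ A) *ᵥ x) (i, j) = (A *ᵥ fun j' => x (i, j')) j := by
  simp only [mulVec, dotProduct, Fintype.sum_prod_type, kroneckerMap_apply]
  rw [Fintype.sum_eq_single i fun i' hi => by simp [one_apply_ne hi.symm]]
  simp

variable [DecidableEq m] [DecidableEq n]

lemma eigenvalueSet_kronecker_one_subset (A : Matrix m m ℂ) :
    eigenvalueSet (A ⊗ₖ (1 : Matrix n n ℂ)) ⊆ eigenvalueSet A := by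
  intro μ hμ
  obtain ⟨x, hx₀, hx⟩ := mem_eigenvalueSet_iff.1 hμ
  obtain ⟨⟨i, j⟩, hij⟩ := Function.ne_iff.1 hx₀
  refine mem_eigenvalueSet_iff.2 ⟨fun i' => x (i', j), fun h => hij (congrFun h i), ?_⟩
  ext i'
  rw [← kronecker_one_mulVec_apply, hx]
  rfl

lemma subset_eigenvalueSet_kronecker_add (A B : Matrix m m ℂ) {P : Matrix n n ℂ} {u : n → ℂ}
    (hu : u ≠ 0) {c : ℂ} (hPu : P *ᵥ u = c • u) :
    eigenvalueSet (A + c • B) ⊆ eigenvalueSet (A ⊗ₖ (1 : Matrix n n ℂ) + B ⊗ₖ P) := by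
  intro μ hμ
  obtain ⟨x, hx₀, hx⟩ := mem_eigenvalueSet_iff.1 hμ
  refine mem_eigenvalueSet_iff.2 ⟨fun p => x p.1 * u p.2, ?_, ?_⟩
  · obtain ⟨i, hi⟩ := Function.ne_iff.1 hx₀
    obtain ⟨j, hj⟩ := Function.ne_iff.1 hu
    exact Function.ne_iff.2 ⟨(i, j), mul_ne_zero hi hj⟩
  · ext p
    have hp := congrFun hx p.1
    rw [add_mulVec, kronecker_mulVec_prod, kronecker_mulVec_prod, one_mulVec, hPu]
    simp only [add_mulVec, smul_mulVec, Pi.add_apply, Pi.smul_apply, smul_eq_mul] at hp ⊢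
    linear_combination u p.2 * hp

lemma eigenvalueSet_kronecker_add_of_isIdempotentElem (A B : Matrix m m ℂ) {P : Matrix n n ℂ}
    (hP : IsIdempotentElem P) (hP₀ : P ≠ 0) (hP₁ : P ≠ 1) :
    eigenvalueSet (A ⊗ₖ (1 : Matrix n n ℂ) + B ⊗ₖ P) = eigenvalueSet A ∪ eigenvalueSet (A + B) := by
  have exists_mulVec_ne_zero {Q : Matrix n n ℂ} (hQ : Q ≠ 0) : ∃ u, Q *ᵥ u ≠ 0 := by
    by_contra! h
    exact hQ (mulVec_injective (funext fun u => by rw [h, zero_mulVec]))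
  refine Set.Subset.antisymm (fun μ hμ => ?_) (Set.union_subset ?_ ?_)
  · obtain ⟨x, hx₀, hx⟩ := mem_eigenvalueSet_iff.1 hμ
    rw [add_mulVec] at hx
    set y := ((1 : Matrix m m ℂ) ⊗ₖ P) *ᵥ x with hy
    rcases eq_or_ne y 0 with hy₀ | hy₀
    · refine .inl (eigenvalueSet_kronecker_one_subset (n := n) A
        (mem_eigenvalueSet_iff.2 ⟨x, hx₀, ?_⟩))
      have hB : (B ⊗ₖ P) *ᵥ x = 0 := by
        rw [← mul_one B, ← one_mul P, mul_kronecker_mul, ← mulVec_mulVec, ← hy, hy₀, mulVec_zero]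
      rwa [hB, add_zero] at hx
    · refine .inr (eigenvalueSet_kronecker_one_subset (n := n) (A + B)
        (mem_eigenvalueSet_iff.2 ⟨y, hy₀, ?_⟩))
      calc ((A + B) ⊗ₖ (1 : Matrix n n ℂ)) *ᵥ y
          = ((1 : Matrix m m ℂ) ⊗ₖ P) *ᵥ ((A ⊗ₖ (1 : Matrix n n ℂ)) *ᵥ x + (B ⊗ₖ P) *ᵥ x) := by
            rw [hy, mulVec_add, mulVec_mulVec, mulVec_mulVec, mulVec_mulVec, ← mul_kronecker_mul,
              ← mul_kronecker_mul, ← mul_kronecker_mul, ← add_mulVec, hP.eq]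
            simp [add_kronecker]
        _ = (μ : ℂ) • y := by rw [hx, mulVec_smul]
  · obtain ⟨u, hu⟩ := exists_mulVec_ne_zero (sub_ne_zero.2 hP₁.symm)
    simpa using subset_eigenvalueSet_kronecker_add A B hu (c := 0)
      (by rw [mulVec_mulVec, mul_sub, mul_one, hP.eq, sub_self, zero_mulVec, zero_smul])
  · obtain ⟨u, hu⟩ := exists_mulVec_ne_zero hP₀
    simpa using subset_eigenvalueSet_kronecker_add A B hu (c := 1)
      (by rw [mulVec_mulVec, hP.eq, one_smul])

end Kronecker

/-! ### History states -/

/-- The primitive eighth root of unity `e^{iπ/4}`. -/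
noncomputable def zeta : ℂ := Complex.exp (Complex.I * Real.pi / 4)

lemma isPrimitiveRoot_zeta : IsPrimitiveRoot zeta 8 := by
  convert Complex.isPrimitiveRoot_exp 8 (by norm_num) using 1
  rw [zeta]
  congr 1
  push_cast
  ring

lemma norm_zeta : ‖zeta‖ = 1 := isPrimitiveRoot_zeta.norm'_eq_one (by norm_num)

lemma zeta_mul_conj_zeta : zeta * conj zeta = 1 := by
  rw [Complex.mul_conj', norm_zeta]
  norm_num

lemma zeta_pow_four : zeta ^ 4 = -1 := by
  rw [zeta, ← Complex.exp_nat_mul, ← Complex.exp_pi_mul_I]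
  congr 1
  push_cast
  ring

lemma conj_zeta : conj zeta = -zeta ^ 3 := by
  linear_combination (-zeta ^ 3) * zeta_mul_conj_zeta + conj zeta * zeta_pow_four

lemma zeta_sq_ne_one : zeta ^ 2 ≠ 1 :=
  isPrimitiveRoot_zeta.pow_ne_one_of_pos_of_lt two_ne_zero (by norm_num)

lemma zeta_add_conj_zeta : zeta + conj zeta = ((√2 : ℝ) : ℂ) := by
  have : zeta = Complex.exp (((Real.pi / 4 : ℝ) : ℂ) * Complex.I) := by
    rw [zeta]
    congr 1
    push_cast
    ring
  rw [Complex.add_conj, this, Complex.exp_ofReal_mul_I_re, Real.cos_pi_div_four]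
  norm_cast
  ring

/-- The character `j ↦ e^{iπj/4}` of `ℤ/8`. -/
noncomputable def zetaChar : AddChar (Fin 8) ℂ where
  toFun j := zeta ^ (j : ℕ)
  map_zero_eq_one' := pow_zero _
  map_add_eq_mul' i j := by
    rw [← pow_add, Fin.val_add]
    exact (pow_eq_pow_mod _ isPrimitiveRoot_zeta.pow_eq_one).symm

lemma zetaChar_apply (j : Fin 8) : zetaChar j = zeta ^ (j : ℕ) := rfl

lemma zetaChar_one : zetaChar 1 = zeta := pow_one zeta

lemma zetaChar_four : zetaChar 4 = -1 := zeta_pow_four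

lemma omegaState_eq (j : Fin 8) : omegaState j = ((1 / √8 : ℝ) : ℂ) * zetaChar (-j) := by
  rw [omegaState, AddChar.map_neg_eq_conj, zetaChar_apply, zeta, ← Complex.exp_nat_mul,
    ← Complex.exp_conj]
  congr 2
  simp only [map_div₀, map_mul, Complex.conj_I, Complex.conj_ofReal, map_ofNat, map_natCast]
  ring

lemma norm_omegaState_sq (j : Fin 8) : ‖omegaState j‖ ^ 2 = 1 / 8 := by
  rw [omegaState_eq, norm_mul, AddChar.norm_apply, Complex.norm_of_nonneg (by positivity)]
  norm_num [div_pow]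

lemma omegaState_sub (j k : Fin 8) : omegaState (j - k) = zetaChar k * omegaState j := by
  rw [omegaState_eq, omegaState_eq, neg_sub, sub_eq_add_neg, AddChar.map_add_eq_mul]
  ring

lemma sum_omegaState_sq : ∑ j, omegaState j ^ 2 = 0 := by
  have invariant : ∑ j, omegaState j ^ 2 = zeta ^ 2 * ∑ j, omegaState j ^ 2 := by
    rw [Finset.mul_sum, ← Equiv.sum_comp (Equiv.subRight (1 : Fin 8))]
    refine Finset.sum_congr rfl fun j _ => ?_
    rw [Equiv.subRight_apply, omegaState_sub, mul_pow, zetaChar_one]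
  refine (mul_eq_zero.1 ?_).resolve_left (sub_ne_zero.2 zeta_sq_ne_one.symm)
  linear_combination invariant

lemma sum_norm_sq_omegaState (α β : ℂ) :
    ∑ j, ‖α * omegaState j + conj (β * omegaState j)‖ ^ 2 = ‖α‖ ^ 2 + ‖β‖ ^ 2 := by
  have expand (j : Fin 8) : ‖α * omegaState j + conj (β * omegaState j)‖ ^ 2 =
      (‖α‖ ^ 2 + ‖β‖ ^ 2) / 8 + 2 * (α * β * omegaState j ^ 2).re := by
    rw [Complex.sq_norm, Complex.normSq_add, Complex.conj_conj, Complex.normSq_conj,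
      ← Complex.sq_norm, ← Complex.sq_norm, norm_mul, norm_mul, mul_pow, mul_pow,
      norm_omegaState_sq]
    ring_nf
  simp only [expand, Finset.sum_add_distrib, ← Finset.mul_sum, ← Complex.re_sum,
    sum_omegaState_sq]
  simp
  ring

lemma sqrt_two_smul_gateH : ((√2 : ℝ) : ℂ) • gateH = !![1, 1; 1, -1] := by
  rw [gateH, smul_smul, ← Complex.ofReal_mul, mul_one_div_cancel (by positivity),
    Complex.ofReal_one, one_smul]

lemma sqrt_two_smul_gateH_mul_gateT :
    ((√2 : ℝ) : ℂ) • (gateH * gateT) = !![1, zeta; 1, -zeta] := by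
  rw [← smul_mul_assoc, sqrt_two_smul_gateH, gateT, ← zeta]
  simp

lemma conjTranspose_gateH : gateHᴴ = gateH := by
  rw [gateH, conjTranspose_smul, RCLike.star_def, Complex.conj_ofReal]
  congr 1
  ext i j
  fin_cases i <;> fin_cases j <;> simp

lemma gateH_mem_unitaryGroup : gateH ∈ unitaryGroup (Fin 2) ℂ := by
  have h : (((√2 : ℝ) : ℂ) * ((√2 : ℝ) : ℂ)) • (gateH * gateH) = (2 : ℂ) • 1 := by
    rw [← smul_mul_smul_comm, sqrt_two_smul_gateH]
    ext i j
    fin_cases i <;> fin_cases j <;> norm_num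
  rw [← Complex.ofReal_mul, Real.mul_self_sqrt zero_le_two, Complex.ofReal_ofNat] at h
  rw [mem_unitaryGroup_iff, star_eq_conjTranspose, conjTranspose_gateH]
  exact smul_right_injective _ two_ne_zero h

lemma gateT_mem_unitaryGroup : gateT ∈ unitaryGroup (Fin 2) ℂ := by
  rw [mem_unitaryGroup_iff, star_eq_conjTranspose, gateT, ← zeta]
  ext i j
  fin_cases i <;> fin_cases j <;> simp [mul_apply, zeta_mul_conj_zeta]

lemma stepUnitary_mem_unitaryGroup (t : Fin 8) : stepUnitary t ∈ unitaryGroup (Fin 2) ℂ := by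
  unfold stepUnitary
  split_ifs
  exacts [gateH_mem_unitaryGroup, mul_mem gateH_mem_unitaryGroup gateT_mem_unitaryGroup,
    one_mem _]

lemma stepUnitary_add_one_mul_conjTranspose (t : Fin 8) :
    stepUnitary (t + 1) * (stepUnitary t)ᴴ =
      if t = 3 ∨ t = 5 then gateH * gateT
      else if t = 4 ∨ t = 6 then (gateH * gateT)ᴴ else gateH := by
  fin_cases t <;> simp [stepUnitary, conjTranspose_gateH]

lemma zetaChar_hopExponent (t : Fin 8) (x z : Fin 2) :
    zetaChar (hopExponent t x z) =
      -(((√2 : ℝ) : ℂ) • (stepUnitary (t + 1) * (stepUnitary t)ᴴ)) x z := by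
  have smul_conjTranspose :
      ((√2 : ℝ) : ℂ) • (gateH * gateT)ᴴ = !![1, 1; conj zeta, -conj zeta] := by
    rw [← Complex.conj_ofReal, ← RCLike.star_def, ← conjTranspose_smul,
      sqrt_two_smul_gateH_mul_gateT]
    ext i j
    fin_cases i <;> fin_cases j <;> simp
  have zeta_pow_five : zeta ^ 5 = -zeta := by linear_combination zeta * zeta_pow_four
  have zeta_pow_seven : zeta ^ 7 = -zeta ^ 3 := by linear_combination zeta ^ 3 * zeta_pow_four
  rw [stepUnitary_add_one_mul_conjTranspose, hopExponent]
  split_ifs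
  · rw [sqrt_two_smul_gateH_mul_gateT]
    fin_cases x <;> fin_cases z <;> simp [zetaChar_apply, zeta_pow_four, zeta_pow_five]
  · rw [smul_conjTranspose]
    fin_cases x <;> fin_cases z <;>
      simp [zetaChar_apply, zeta_pow_four, zeta_pow_seven, conj_zeta]
  · rw [sqrt_two_smul_gateH]
    fin_cases x <;> fin_cases z <;> simp [zetaChar_apply, zeta_pow_four]

lemma sum_norm_sq_mulVec {n : Type*} [Fintype n] [DecidableEq n] {U : Matrix n n ℂ}
    (hU : U ∈ unitaryGroup n ℂ) (x : n → ℂ) : ∑ i, ‖(U *ᵥ x) i‖ ^ 2 = ∑ i, ‖x i‖ ^ 2 := by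
  have sum_norm_sq (y : n → ℂ) : ((∑ i, ‖y i‖ ^ 2 : ℝ) : ℂ) = star y ⬝ᵥ y := by
    simp [dotProduct, Complex.conj_mul']
  rw [← Complex.ofReal_inj, sum_norm_sq, sum_norm_sq, star_mulVec, ← dotProduct_mulVec,
    mulVec_mulVec, ← star_eq_conjTranspose, mem_unitaryGroup_iff'.1 hU, one_mulVec]

/-- The vector `∑ₜ V_t a ⊗ |t⟩ ⊗ |ω⟩` of the three registers, where `V_t` is `stepUnitary t`: the
unnormalised history of the computation that starts in `a`. -/
noncomputable def historyState (a : Fin 2 → ℂ) : Vertex0 → ℂ := fun v =>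
  (stepUnitary v.2.1 *ᵥ a) v.1 * omegaState v.2.2

/-- The span of the four states `|ψ_{z,a}⟩`. -/
noncomputable def psiSpan : Submodule ℂ (Vertex0 → ℂ) :=
  Submodule.span ℂ (Set.range fun za : Fin 2 × Fin 2 => psi za.1 za.2)

lemma mem_psiSpan_iff {f : Vertex0 → ℂ} :
    f ∈ psiSpan ↔ ∃ a b, f = historyState a + star (historyState b) := by
  have expand (c : Fin 2 × Fin 2 → ℂ) : ∑ za, c za • psi za.1 za.2 =
      historyState (((1 / √8 : ℝ) : ℂ) • fun z => c (z, 0)) +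
        star (historyState (((1 / √8 : ℝ) : ℂ) • star fun z => c (z, 1))) := by
    ext v
    simp only [historyState, psi, Fintype.sum_prod_type, Fin.sum_univ_two, mulVec, dotProduct,
      Pi.add_apply, Pi.smul_apply, Pi.star_apply, smul_eq_mul, RCLike.star_def, map_add, map_mul,
      Complex.conj_conj, Complex.conj_ofReal, if_true, one_ne_zero, if_false]
    ring
  rw [psiSpan, Submodule.mem_span_range_iff_exists_fun]
  constructor
  · rintro ⟨c, rfl⟩
    exact ⟨_, _, expand c⟩
  · rintro ⟨a, b, rfl⟩
    refine ⟨fun za => ((1 / √8 : ℝ) : ℂ)⁻¹ * if za.2 = 0 then a za.1 else conj (b za.1), ?_⟩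
    rw [expand]
    congr 3 <;> ext z <;> simp

lemma sum_norm_sq_of_mem_psiSpan {f : Vertex0 → ℂ} (hf : f ∈ psiSpan) (t t' : Fin 8) :
    ∑ z, ∑ j, ‖f (z, t, j)‖ ^ 2 = ∑ z, ∑ j, ‖f (z, t', j)‖ ^ 2 := by
  obtain ⟨a, b, rfl⟩ := mem_psiSpan_iff.1 hf
  simp only [historyState, Pi.add_apply, Pi.star_apply, RCLike.star_def, sum_norm_sq_omegaState,
    Finset.sum_add_distrib, sum_norm_sq_mulVec (stepUnitary_mem_unitaryGroup _)]

lemma sum_norm_sq_eq_of_mem_psiSpan {f : Vertex0 → ℂ} (hf : f ∈ psiSpan) (t : Fin 8) :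
    ∑ v, ‖f v‖ ^ 2 = 8 * ∑ z, ∑ j, ‖f (z, t, j)‖ ^ 2 := by
  calc ∑ v, ‖f v‖ ^ 2 = ∑ t', ∑ z, ∑ j, ‖f (z, t', j)‖ ^ 2 := by
        simp only [Fintype.sum_prod_type]
        exact Finset.sum_comm
    _ = ∑ _t' : Fin 8, ∑ z, ∑ j, ‖f (z, t, j)‖ ^ 2 :=
        Finset.sum_congr rfl fun t' _ => sum_norm_sq_of_mem_psiSpan hf t' t
    _ = 8 * ∑ z, ∑ j, ‖f (z, t, j)‖ ^ 2 := by
        rw [Finset.sum_const, Finset.card_univ, Fintype.card_fin, nsmul_eq_mul, Nat.cast_ofNat]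

lemma add_eq_zero_of_mem_psiSpan {f : Vertex0 → ℂ} (hf : f ∈ psiSpan) (z : Fin 2) (t : Fin 8) :
    f (z, t, 0) + f (z, t, 4) = 0 := by
  obtain ⟨a, b, rfl⟩ := mem_psiSpan_iff.1 hf
  have omegaState_four : omegaState 4 = -omegaState 0 := by
    rw [← sub_self 4, omegaState_sub, zetaChar_four, neg_one_mul, neg_neg]
  simp only [historyState, Pi.add_apply, Pi.star_apply, omegaState_four, mul_neg, star_neg]
  ring

/-! ### Gate graphs -/

section Nodes

/-- A time `t` at which the diagram elements with the given label have no nodes. -/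
def ElementLabel.unusedTime : ElementLabel → Fin 8
  | .one => 2
  | .H => 5
  | .HT => 5

lemma ElementLabel.unusedTime_notMem (l : ElementLabel) : l.unusedTime ∉ l.times := by
  cases l <;> decide

variable {R : ℕ}

lemma nodeOperator_apply (x : Node R → ℂ) (v w : Vertex R) :
    nodeOperator x v w = x v.node * x w.node * (1 : Matrix (Fin 8) (Fin 8) ℂ) v.2.2.2 w.2.2.2 :=
  rfl

lemma posSemidef_nodeOperator {x : Node R → ℂ} (hx : star x = x) :
    (nodeOperator x).PosSemidef := by
  have h := posSemidef_vecMulVec_self_star x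
  rw [hx] at h
  exact (h.kronecker PosSemidef.one).submatrix _

end Nodes

namespace GateDiagram

variable {R : ℕ} (D : GateDiagram R)

lemma posSemidef_hS : D.hS.PosSemidef :=
  posSemidef_sum _ fun n _ => posSemidef_nodeOperator <| by
    rw [← Pi.single_star, star_one]

lemma posSemidef_hE : D.hE.PosSemidef :=
  posSemidef_sum _ fun e _ => posSemidef_nodeOperator <| by
    ext n
    simp [apply_ite]

section NotMemTimes

variable {D} {v : Vertex R} (hv : v.2.2.1 ∉ (D.label v.1).times)
include hv

lemma mem_noLoop_of_notMem_times : v ∈ D.noLoop :=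
  ⟨fun h => hv (D.mem_times_of_mem_S _ h),
    fun _ h => hv (D.mem_times_of_mem_E _ h v.node (Sym2.mem_mk_left _ _))⟩

lemma hS_apply_of_notMem_times (w : Vertex R) : D.hS v w = 0 := by
  rw [hS, Matrix.sum_apply]
  refine Finset.sum_eq_zero fun n hn => ?_
  have : v.node ≠ n := fun h => hv (D.mem_times_of_mem_S _ (h ▸ hn))
  simp [nodeOperator_apply, this]

lemma hE_apply_of_notMem_times (w : Vertex R) : D.hE v w = 0 := by
  rw [hE, Matrix.sum_apply]
  refine Finset.sum_eq_zero fun e he => ?_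
  have : v.node ∉ e := fun h => hv (D.mem_times_of_mem_E e he _ h)
  simp [nodeOperator_apply, this]

end NotMemTimes

variable (g : SimpleGraph Vertex0) [DecidableRel g.Adj]

lemma adj_sub_smul_one (c : ℂ) : D.adj g - c • 1 =
    (1 : Matrix (Fin R) (Fin R) ℂ) ⊗ₖ (g.adjMatrix ℂ - c • 1) + (D.hS + D.hE) := by
  rw [sub_eq_add_neg, ← neg_smul, sub_eq_add_neg, ← neg_smul, kronecker_add, kronecker_smul,
    one_kronecker_one, adj]
  abel

lemma adj_sub_smul_one_apply_of_notMem_times (c : ℂ) {q : Fin R} {v : Vertex0}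
    (hv : v.2.1 ∉ (D.label q).times) (w : Vertex0) :
    (D.adj g - c • 1) (q, v) (q, w) = (g.adjMatrix ℂ - c • 1) v w := by
  have hS := hS_apply_of_notMem_times (D := D) (v := (q, v)) hv (q, w)
  have hE := hE_apply_of_notMem_times (D := D) (v := (q, v)) hv (q, w)
  rw [adj_sub_smul_one, Matrix.add_apply, Matrix.add_apply, hS, hE, kroneckerMap_apply,
    one_apply_eq, one_mul, add_zero, add_zero]

variable {g}

lemma posSemidef_adj_sub (hg : HasG0Spectrum g) : (D.adj g - (e1 : ℂ) • 1).PosSemidef := by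
  rw [adj_sub_smul_one]
  exact (PosSemidef.one.kronecker
    (posSemidef_sub_of_isLeast (g.isHermitian_adjMatrix ℂ) hg.isLeast_e1)).add
      (D.posSemidef_hS.add D.posSemidef_hE)

variable {D}

lemma mem_psiSpan_of_mulVec_eq_zero (hg : HasG0Spectrum g) {k : Vertex R → ℂ}
    (hk : (D.adj g - (e1 : ℂ) • 1) *ᵥ k = 0) (q : Fin R) : (fun v => k (q, v)) ∈ psiSpan := by
  rw [adj_sub_smul_one] at hk
  have ker_kronecker := mulVec_eq_zero_of_posSemidef_add
    (PosSemidef.one.kronecker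
      (posSemidef_sub_of_isLeast (g.isHermitian_adjMatrix ℂ) hg.isLeast_e1))
    (D.posSemidef_hS.add D.posSemidef_hE) hk
  rw [psiSpan, ← hg.eigenspace_e1, Module.End.mem_eigenspace_iff, toLin'_apply, ← sub_eq_zero]
  ext v
  have := congrFun ker_kronecker (q, v)
  rwa [one_kronecker_mulVec_apply, sub_mulVec, smul_mulVec, one_mulVec] at this

variable (D) in
open Classical in
/-- The diagonal entries of `2 Π_𝒩`. -/
noncomputable def noLoopWeight (v : Vertex R) : ℝ := if v ∈ D.noLoop then 2 else 0

lemma noLoopWeight_nonneg (v : Vertex R) : 0 ≤ D.noLoopWeight v := by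
  unfold noLoopWeight
  split_ifs <;> norm_num

lemma noLoopWeight_le_two (v : Vertex R) : D.noLoopWeight v ≤ 2 := by
  unfold noLoopWeight
  split_ifs <;> norm_num

/-- On each diagram element a kernel vector is a superposition of history states, and these spread
their weight evenly over the eight times, one of which is unused. -/
lemma mul_sum_norm_sq_le_of_mulVec_eq_zero (hg : HasG0Spectrum g) {k : Vertex R → ℂ}
    (hk : (D.adj g - (e1 : ℂ) • 1) *ᵥ k = 0) :
    1 / 4 * ∑ v, ‖k v‖ ^ 2 ≤ ∑ v, D.noLoopWeight v * ‖k v‖ ^ 2 := by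
  rw [Fintype.sum_prod_type, Fintype.sum_prod_type, Finset.mul_sum]
  refine Finset.sum_le_sum fun q _ => ?_
  set u := (D.label q).unusedTime
  have weight (z : Fin 2) (j : Fin 8) : D.noLoopWeight (q, z, u, j) = 2 :=
    if_pos (mem_noLoop_of_notMem_times (ElementLabel.unusedTime_notMem _))
  calc 1 / 4 * ∑ v, ‖k (q, v)‖ ^ 2
      = ∑ z, ∑ j, D.noLoopWeight (q, z, u, j) * ‖k (q, z, u, j)‖ ^ 2 := by
        rw [sum_norm_sq_eq_of_mem_psiSpan (mem_psiSpan_of_mulVec_eq_zero hg hk q) u]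
        simp only [weight, ← Finset.mul_sum]
        ring
    _ ≤ ∑ z, ∑ t, ∑ j, D.noLoopWeight (q, z, t, j) * ‖k (q, z, t, j)‖ ^ 2 := by
        refine Finset.sum_le_sum fun z _ => Finset.single_le_sum (fun t _ => ?_)
          (Finset.mem_univ u) (f := fun t => ∑ j, D.noLoopWeight (q, z, t, j) *
            ‖k (q, z, t, j)‖ ^ 2)
        exact Finset.sum_nonneg fun j _ => mul_nonneg (noLoopWeight_nonneg _) (sq_nonneg _)
    _ = ∑ v, D.noLoopWeight (q, v) * ‖k (q, v)‖ ^ 2 := by simp only [Fintype.sum_prod_type]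

/-- The test vector `|q, 0, t, 0⟩ + |q, 0, t, 4⟩` at an unused time `t` is orthogonal to the kernel,
since `ω` changes sign under `j ↦ j + 4`. -/
lemma exists_mem_eigenvalueSet_le_seven (hg : HasG0Spectrum g) (q : Fin R) :
    ∃ μ ∈ eigenvalueSet (D.adj g - (e1 : ℂ) • 1) \ {0}, μ ≤ 7 := by
  set u := (D.label q).unusedTime
  obtain ⟨μ, hμ, hle⟩ := exists_mem_eigenvalueSet_two_mul_le (D.posSemidef_adj_sub hg).1
    (v := (q, 0, u, 0)) (w := (q, 0, u, 4)) (by simp) fun k hk =>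
      add_eq_zero_of_mem_psiSpan (mem_psiSpan_of_mulVec_eq_zero hg hk q) 0 u
  refine ⟨μ, hμ, ?_⟩
  have entry (j : Fin 8) (v : Vertex0) := D.adj_sub_smul_one_apply_of_notMem_times g (e1 : ℂ)
    (q := q) (v := (0, u, j)) (ElementLabel.unusedTime_notMem _) v
  have entry_self (v : Vertex0) : ((g.adjMatrix ℂ - (e1 : ℂ) • 1) v v).re = -e1 := by simp
  have entry_ne {v w : Vertex0} (h : v ≠ w) : ((g.adjMatrix ℂ - (e1 : ℂ) • 1) v w).re ≤ 1 := by
    by_cases hadj : g.Adj v w <;> simp [hadj, h]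
  have sqrt_two_le : √2 ≤ 5 / 3 := Real.sqrt_le_iff.2 (by norm_num)
  simp only [entry, entry_self, Complex.add_re] at hle
  have hvw := entry_ne (v := (0, u, 0)) (w := (0, u, 4)) (by simp)
  have hwv := entry_ne (v := (0, u, 4)) (w := (0, u, 0)) (by simp)
  unfold e1 at hle hvw hwv
  linarith

variable (D g) in
lemma adjSL_sub_smul_one (c : ℂ) : D.adjSL g - c • 1 =
    (D.adj g - c • 1) ⊗ₖ (1 : Matrix (Fin 2) (Fin 2) ℂ) +
      (diagonal fun v => (D.noLoopWeight v : ℂ)) ⊗ₖ ((1 / 2 : ℂ) • !![1, 1; 1, 1]) := by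
  have two_smul_projNoLoop :
      (2 : ℂ) • D.projNoLoop = diagonal fun v => (D.noLoopWeight v : ℂ) := by
    rw [projNoLoop, ← diagonal_smul]
    congr 1
    ext v
    simp [noLoopWeight, apply_ite]
  rw [sub_eq_add_neg, ← neg_smul, sub_eq_add_neg, ← neg_smul, add_kronecker, smul_kronecker,
    one_kronecker_one, ← two_smul_projNoLoop, smul_kronecker, adjSL]
  abel

variable (D g) in
lemma eigenvalueSet_adjSL_sub (c : ℂ) : eigenvalueSet (D.adjSL g - c • 1) =
    eigenvalueSet (D.adj g - c • 1) ∪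
      eigenvalueSet (D.adj g - c • 1 + diagonal fun v => (D.noLoopWeight v : ℂ)) := by
  rw [adjSL_sub_smul_one]
  refine eigenvalueSet_kronecker_add_of_isIdempotentElem _ _ ?_ ?_ ?_
  · ext i j
    fin_cases i <;> fin_cases j <;> norm_num
  · intro h
    simpa using congrFun₂ h 0 0
  · intro h
    simpa using congrFun₂ h 0 1

lemma le_of_mem_eigenvalueSet_adjSL_sub (hg : HasG0Spectrum g) {γ μ : ℝ} (hγ₀ : 0 ≤ γ)
    (hγ₇ : γ ≤ 7) (hγ : γ ∈ lowerBounds (eigenvalueSet (D.adj g - (e1 : ℂ) • 1) \ {0}))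
    (hμ : μ ∈ eigenvalueSet (D.adjSL g - (e1 : ℂ) • 1) \ {0}) : 1 / 37 * γ ≤ μ := by
  obtain ⟨hμ, hμ₀⟩ := hμ
  rw [eigenvalueSet_adjSL_sub] at hμ
  rcases hμ with hμ | hμ
  · exact le_trans (by linarith) (hγ ⟨hμ, hμ₀⟩)
  · refine le_trans ?_ (le_of_mem_eigenvalueSet_add_diagonal (D.posSemidef_adj_sub hg).1
      (c := 1 / 4) (by norm_num) hγ₀ hγ noLoopWeight_nonneg noLoopWeight_le_two
      (fun k => mul_sum_norm_sq_le_of_mulVec_eq_zero hg) hμ)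
    rw [le_div_iff₀ (by positivity)]
    nlinarith

lemma exists_isSmallestNonzeroEigenvalue_le_adjSL (hg : HasG0Spectrum g) (hR : 0 < R) :
    ∃ γ γSL : ℝ, IsSmallestNonzeroEigenvalue (D.adj g - (e1 : ℂ) • 1) γ ∧
      IsSmallestNonzeroEigenvalue (D.adjSL g - (e1 : ℂ) • 1) γSL ∧ 1 / 37 * γ ≤ γSL := by
  obtain ⟨μ, hμ, hμ₇⟩ := exists_mem_eigenvalueSet_le_seven (D := D) hg ⟨0, hR⟩
  obtain ⟨γ, hγ⟩ := exists_isSmallestNonzeroEigenvalue ⟨μ, hμ⟩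
  obtain ⟨γSL, hγSL⟩ := exists_isSmallestNonzeroEigenvalue (A := D.adjSL g - (e1 : ℂ) • 1)
    ⟨μ, by rw [eigenvalueSet_adjSL_sub]; exact .inl hμ.1, hμ.2⟩
  have γ_nonneg : 0 ≤ γ := nonneg_of_mem_eigenvalueSet (D.posSemidef_adj_sub hg) hγ.1.1
  exact ⟨γ, γSL, hγ, hγSL, le_of_mem_eigenvalueSet_adjSL_sub hg γ_nonneg ((hγ.2 hμ).trans hμ₇)
    hγ.2 hγSL.1⟩

lemma IsE1GateGraph.pos (hD : D.IsE1GateGraph g) : 0 < R := by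
  obtain ⟨x, hx, -⟩ := mem_eigenvalueSet_iff.1 hD.1
  obtain ⟨v, -⟩ := Function.ne_iff.1 hx
  exact v.1.pos

end GateDiagram

/-! ### Eigenfunctions on a cycle -/

lemma norm_mulVec_le_card_mul {m n : Type*} [Fintype m] [Fintype n] {A : Matrix m n ℂ}
    (hA : ∀ i j, ‖A i j‖ ≤ 1) (x : n → ℂ) : ‖A *ᵥ x‖ ≤ Fintype.card n * ‖x‖ := by
  refine (pi_norm_le_iff_of_nonneg (by positivity)).2 fun i => ?_
  calc ‖(A *ᵥ x) i‖ ≤ ∑ j, ‖A i j * x j‖ := norm_sum_le _ _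
    _ ≤ ∑ _j : n, ‖x‖ := Finset.sum_le_sum fun j _ => by
        rw [norm_mul]
        exact (mul_le_of_le_one_left (norm_nonneg _) (hA i j)).trans (norm_le_pi_norm x j)
    _ = Fintype.card n * ‖x‖ := by simp

section Translation

variable {G E : Type*} [AddGroup G] [NormedAddCommGroup E] [InnerProductSpace ℝ E]
  {s : G} {f : G → E} {ν : ℝ}

lemma sum_norm_sub_sq_of_smul_eq [Fintype G] (hf : ∀ t, ν • f t = f (t - s) + f (t + s)) :
    ∑ t, ‖f (t + s) - f t‖ ^ 2 = (2 - ν) * ∑ t, ‖f t‖ ^ 2 := by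
  have shift (h : G → ℝ) : ∑ t, h (t + s) = ∑ t, h t := Equiv.sum_comp (Equiv.addRight s) h
  have cross : ∑ t, ⟪f t, f (t - s)⟫_ℝ = ∑ t, ⟪f (t + s), f t⟫_ℝ := by
    rw [← shift]
    simp only [add_sub_cancel_right]
  have pairing : ν * ∑ t, ‖f t‖ ^ 2 = 2 * ∑ t, ⟪f (t + s), f t⟫_ℝ := by
    calc ν * ∑ t, ‖f t‖ ^ 2 = ∑ t, ⟪f t, ν • f t⟫_ℝ := by
          simp only [real_inner_smul_right, real_inner_self_eq_norm_sq, Finset.mul_sum]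
      _ = 2 * ∑ t, ⟪f (t + s), f t⟫_ℝ := by
          simp only [hf, inner_add_right, Finset.sum_add_distrib, cross, two_mul,
            real_inner_comm (f (_ + s))]
  simp only [norm_sub_sq_real, Finset.sum_add_distrib, Finset.sum_sub_distrib, ← Finset.mul_sum,
    shift fun t => ‖f t‖ ^ 2]
  linear_combination pairing

lemma periodic_of_smul_eq [Finite G] (hν : 2 ≤ ν) (hf : ∀ t, ν • f t = f (t - s) + f (t + s)) :
    Function.Periodic f s := by
  have := Fintype.ofFinite G
  have h : ∑ t, ‖f (t + s) - f t‖ ^ 2 ≤ 0 := by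
    rw [sum_norm_sub_sq_of_smul_eq hf]
    exact mul_nonpos_of_nonpos_of_nonneg (by linarith) (by positivity)
  intro t
  have := Finset.single_le_sum (f := fun t => ‖f (t + s) - f t‖ ^ 2)
    (fun t _ => by positivity) (Finset.mem_univ t)
  exact sub_eq_zero.1 (norm_eq_zero.1 (pow_eq_zero_iff two_ne_zero |>.1
    (le_antisymm (this.trans h) (by positivity))))

end Translation

/-! ### Characters of `ℤ/8` -/

lemma val_nsmul_one (j : Fin 8) : (j : ℕ) • (1 : Fin 8) = j := by decide +revert

lemma addChar_apply (χ : AddChar (Fin 8) ℂ) (j : Fin 8) : χ j = χ 1 ^ (j : ℕ) := by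
  rw [← AddChar.map_nsmul_eq_pow, val_nsmul_one]

lemma addChar_eq_of_apply_one {χ ψ : AddChar (Fin 8) ℂ} (h : χ 1 = ψ 1) : χ = ψ := by
  ext j
  rw [addChar_apply χ, addChar_apply ψ, h]

/-- The factor by which the translations `S³ + S⁴ + S⁵` act on the character `χ`. -/
def loopEigenvalue (χ : AddChar (Fin 8) ℂ) : ℂ := χ 3 + χ 4 + χ 5

lemma conj_add_conj_add_conj (χ : AddChar (Fin 8) ℂ) :
    conj (χ 3) + conj (χ 4) + conj (χ 5) = loopEigenvalue χ := by
  simp only [← AddChar.map_neg_eq_conj, loopEigenvalue]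
  change χ 5 + χ 4 + χ 3 = _
  ring

lemma loopEigenvalue_zetaChar : loopEigenvalue zetaChar = ((-1 - √2 : ℝ) : ℂ) := by
  have h3 : zetaChar 3 = -conj zeta := by rw [conj_zeta, neg_neg]; rfl
  have h5 : zetaChar 5 = -zeta := by
    rw [show (5 : Fin 8) = 4 + 1 from rfl, AddChar.map_add_eq_mul, zetaChar_four, neg_one_mul,
      zetaChar_one]
  rw [loopEigenvalue, h3, zetaChar_four, h5]
  push_cast
  linear_combination -zeta_add_conj_zeta

/- `ω⁴ = -1` gives `ω̄² = -ω²`, hence `(2 Re ω)² = 2`; on the unit circle, `Re ω = Re ζ` forces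
`ω = ζ` or `ω = ζ̄`. -/
lemma re_nonpos_of_pow_four_eq_neg_one {ω : ℂ} (h4 : ω ^ 4 = -1) (h : ω ≠ zeta)
    (h' : ω ≠ conj zeta) : ω.re ≤ 0 := by
  have norm_ω : ‖ω‖ = 1 :=
    (pow_eq_one_iff_of_nonneg (norm_nonneg ω) four_ne_zero).1 (by rw [← norm_pow, h4]; simp)
  have ω_mul_conj : ω * conj ω = 1 := by
    rw [Complex.mul_conj', norm_ω]
    norm_num
  have two_re_sq : (2 * ω.re) ^ 2 = 2 := by
    have : (ω + conj ω) ^ 2 = 2 := by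
      linear_combination (2 - (ω * conj ω + 1) * ω ^ 2) * ω_mul_conj + conj ω ^ 2 * h4
    rw [Complex.add_conj] at this
    exact_mod_cast this
  by_contra! re_pos
  have add_conj_eq : ω + conj ω = zeta + conj zeta := by
    rw [Complex.add_conj, zeta_add_conj_zeta, ← Real.sqrt_sq (by positivity : 0 ≤ 2 * ω.re),
      two_re_sq]
  have factor : (ω - zeta) * (ω - conj zeta) = 0 := by
    linear_combination ω * add_conj_eq - ω_mul_conj + zeta_mul_conj_zeta
  rcases mul_eq_zero.1 factor with h0 | h0
  · exact h (sub_eq_zero.1 h0)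
  · exact h' (sub_eq_zero.1 h0)

lemma exists_loopEigenvalue_eq {χ : AddChar (Fin 8) ℂ} (h : χ ≠ zetaChar) (h' : χ ≠ zetaChar⁻¹) :
    ∃ c : ℝ, -1 ≤ c ∧ loopEigenvalue χ = c := by
  set ω : ℂ := χ 1 with hω
  have loop_eq : loopEigenvalue χ = ω ^ 4 + ((2 * (ω ^ 3).re : ℝ) : ℂ) := by
    rw [loopEigenvalue, show (5 : Fin 8) = -3 from rfl, AddChar.map_neg_eq_conj,
      ← Complex.add_conj, addChar_apply χ 3, addChar_apply χ 4]
    change ω ^ 3 + ω ^ 4 + conj (ω ^ 3) = _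
    ring
  have ω_pow_four_sq : (ω ^ 4) ^ 2 = 1 := by
    rw [← pow_mul, hω, ← AddChar.map_nsmul_eq_pow]
    exact χ.map_zero_eq_one
  have ω_ne : ω ≠ zeta := fun h0 => h (addChar_eq_of_apply_one (h0.trans zetaChar_one.symm))
  have ω_ne' : ω ≠ conj zeta := fun h0 => h' <| addChar_eq_of_apply_one <| by
    rw [AddChar.inv_apply, AddChar.map_neg_eq_conj, zetaChar_one, ← h0]
  rcases sq_eq_one_iff.1 ω_pow_four_sq with h4 | h4
  · refine ⟨1 + 2 * (ω ^ 3).re, ?_, by rw [loop_eq, h4]; push_cast; ring⟩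
    have := Complex.abs_re_le_norm (ω ^ 3)
    rw [norm_pow, hω, AddChar.norm_apply, one_pow, abs_le] at this
    linarith
  · have ω_cube : ω ^ 3 = -conj ω := by
      have : ω * conj ω = 1 := by rw [Complex.mul_conj', hω, AddChar.norm_apply]; norm_num
      linear_combination conj ω * h4 - ω ^ 3 * this
    refine ⟨-1 + 2 * (ω ^ 3).re, ?_, by rw [loop_eq, h4]; push_cast; ring⟩
    rw [ω_cube, Complex.neg_re, Complex.conj_re]
    linarith [re_nonpos_of_pow_four_eq_neg_one h4 ω_ne ω_ne']

/-! ### The spectrum of `g₀` -/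

lemma g0_adj_iff (z z' : Fin 2) (t t' j j' : Fin 8) :
    g0.Adj (z, t, j) (z', t', j') ↔
      (t' = t - 1 ∧ j' = j - hopExponent (t - 1) z z') ∨
      (t' = t + 1 ∧ j' = j + hopExponent t z' z) ∨
      (z' = z ∧ t' = t ∧ (j' = j + 3 ∨ j' = j + 4 ∨ j' = j + 5)) := by
  have ht : t = t' + 1 ↔ t' = t - 1 := by rw [eq_sub_iff_add_eq, eq_comm]
  have hj (k : Fin 8) : j = j' + k ↔ j' = j - k := by rw [eq_sub_iff_add_eq, eq_comm]
  have h3 : j - 3 = j + 5 := by omega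
  have h4 : j - 4 = j + 4 := by omega
  have hne : ∀ s : Fin 8, s ≠ s + 1 ∧ s ≠ s - 1 ∧ s ≠ s + 3 ∧ s ≠ s + 4 ∧ s ≠ s + 5 := by decide
  simp only [g0, SimpleGraph.fromRel_adj, ht, hj, h3, h4, ne_eq, Prod.mk.injEq]
  constructor
  · rintro ⟨-, (h | ⟨h, h', h''⟩) | ⟨rfl, h⟩ | ⟨h, h', h''⟩⟩
    · exact .inr (.inl h)
    · exact .inr (.inr ⟨h, h', by tauto⟩)
    · exact .inl ⟨rfl, h⟩
    · exact .inr (.inr ⟨h.symm, h'.symm, by tauto⟩)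
  · rintro (⟨rfl, h⟩ | ⟨rfl, h⟩ | ⟨rfl, rfl, h⟩)
    · exact ⟨fun h' => (hne t).2.1 h'.2.1, .inr (.inl ⟨rfl, h⟩)⟩
    · exact ⟨fun h' => (hne t).1 h'.2.1, .inl (.inl ⟨rfl, h⟩)⟩
    · obtain ⟨-, -, hj3, hj4, hj5⟩ := hne j
      rcases h with rfl | rfl | rfl
      · exact ⟨fun h => hj3 h.2.2, .inl (.inr ⟨rfl, rfl, .inl rfl⟩)⟩
      · exact ⟨fun h => hj4 h.2.2, .inl (.inr ⟨rfl, rfl, .inr rfl⟩)⟩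
      · exact ⟨fun h => hj5 h.2.2, .inr (.inr ⟨rfl, rfl, .inl rfl⟩)⟩

lemma g0_adjMatrix_apply (z z' : Fin 2) (t t' j j' : Fin 8) :
    g0.adjMatrix ℂ (z, t, j) (z', t', j') =
      (if t' = t - 1 then if j' = j - hopExponent (t - 1) z z' then 1 else 0 else 0) +
      (if t' = t + 1 then if j' = j + hopExponent t z' z then 1 else 0 else 0) +
      (if z' = z then if t' = t then (if j' = j + 3 then 1 else 0) +
        (if j' = j + 4 then 1 else 0) + (if j' = j + 5 then 1 else 0) else 0 else 0) := by
  have hne : ∀ s : Fin 8, s - 1 ≠ s + 1 ∧ s + 1 ≠ s ∧ s - 1 ≠ s ∧ s + 3 ≠ s + 4 ∧ s + 3 ≠ s + 5 ∧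
    s + 4 ≠ s + 5 := by decide
  have := hne t
  have := hne j
  rw [SimpleGraph.adjMatrix_apply]
  simp only [g0_adj_iff]
  grind

lemma g0_adjMatrix_mulVec (x : Vertex0 → ℂ) (z : Fin 2) (t j : Fin 8) :
    (g0.adjMatrix ℂ *ᵥ x) (z, t, j) =
      ∑ z', x (z', t - 1, j - hopExponent (t - 1) z z') +
      ∑ z', x (z', t + 1, j + hopExponent t z' z) +
      (x (z, t, j + 3) + x (z, t, j + 4) + x (z, t, j + 5)) := by
  simp only [mulVec, dotProduct, Fintype.sum_prod_type, g0_adjMatrix_apply, add_mul, ite_mul,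
    one_mul, zero_mul, Finset.sum_add_distrib, Finset.sum_ite_irrel, Finset.sum_const_zero,
    Finset.sum_ite_eq', Finset.mem_univ, if_true]

lemma adjMatrix_mulVec_star {V : Type*} [Fintype V] (g : SimpleGraph V) [DecidableRel g.Adj]
    (x : V → ℂ) : g.adjMatrix ℂ *ᵥ star x = star (g.adjMatrix ℂ *ᵥ x) := by
  ext v
  simp

/-- The matrix obtained from `B_t` by replacing the cyclic shift of the third register by its
eigenvalue on the character `χ`. -/
def hopMatrix (χ : AddChar (Fin 8) ℂ) (t : Fin 8) : Matrix (Fin 2) (Fin 2) ℂ :=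
  of fun x z => χ (hopExponent t x z)

/-- The action of `A(g₀)` on the component of character `χ` in the third register; such a component
is a family of vectors of the first register indexed by `t`. -/
noncomputable def blochOperator (χ : AddChar (Fin 8) ℂ) (y : Fin 8 → Fin 2 → ℂ) :
    Fin 8 → Fin 2 → ℂ := fun t =>
  hopMatrix χ (t - 1) *ᵥ y (t - 1) + (hopMatrix χ t)ᴴ *ᵥ y (t + 1) + loopEigenvalue χ • y t

/-- The (unnormalised) Fourier coefficient of `x` at the character `χ` of the third register. -/
noncomputable def fourierCoeff (χ : AddChar (Fin 8) ℂ) (x : Vertex0 → ℂ) :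
    Fin 8 → Fin 2 → ℂ := fun t z => ∑ j, χ j * x (z, t, j)

lemma sum_fourierCoeff (x : Vertex0 → ℂ) (z : Fin 2) (t j : Fin 8) :
    ∑ χ : AddChar (Fin 8) ℂ, χ (-j) * fourierCoeff χ x t z = 8 * x (z, t, j) := by
  simp only [fourierCoeff, Finset.mul_sum, ← mul_assoc, ← AddChar.map_add_eq_mul]
  rw [Finset.sum_comm]
  simp only [← Finset.sum_mul, AddChar.sum_apply_eq_ite, neg_add_eq_zero, ite_mul, zero_mul,
    Finset.sum_ite_eq, Finset.mem_univ, if_true, Fintype.card_fin, Nat.cast_ofNat]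

lemma fourierCoeff_smul (χ : AddChar (Fin 8) ℂ) (c : ℂ) (x : Vertex0 → ℂ) :
    fourierCoeff χ (c • x) = c • fourierCoeff χ x := by
  ext t z
  simp only [fourierCoeff, Pi.smul_apply, smul_eq_mul, Finset.mul_sum, mul_left_comm c]

lemma fourierCoeff_inv (χ : AddChar (Fin 8) ℂ) (x : Vertex0 → ℂ) :
    fourierCoeff χ⁻¹ x = star (fourierCoeff χ (star x)) := by
  ext t z
  simp [fourierCoeff, AddChar.inv_apply, AddChar.map_neg_eq_conj]

lemma fourierCoeff_g0_adjMatrix_mulVec (χ : AddChar (Fin 8) ℂ) (x : Vertex0 → ℂ) :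
    fourierCoeff χ (g0.adjMatrix ℂ *ᵥ x) = blochOperator χ (fourierCoeff χ x) := by
  ext t z
  have shift_sub (z t k) : ∑ j, χ j * x (z, t, j - k) = χ k * fourierCoeff χ x t z := by
    rw [← Equiv.sum_comp (Equiv.addRight k), fourierCoeff, Finset.mul_sum]
    refine Finset.sum_congr rfl fun j _ => ?_
    rw [Equiv.coe_addRight, add_sub_cancel_right, AddChar.map_add_eq_mul]
    ring
  have shift_add (z t k) : ∑ j, χ j * x (z, t, j + k) = conj (χ k) * fourierCoeff χ x t z := by
    simpa only [sub_neg_eq_add, AddChar.map_neg_eq_conj] using shift_sub z t (-k)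
  rw [fourierCoeff]
  simp only [g0_adjMatrix_mulVec, mul_add, Finset.sum_add_distrib, Finset.mul_sum]
  rw [Finset.sum_comm, Finset.sum_comm (f := fun j z' => χ j * x (z', t + 1, _))]
  simp only [shift_sub, shift_add, blochOperator, ← conj_add_conj_add_conj χ, hopMatrix, mulVec,
    dotProduct, conjTranspose_apply, of_apply, Pi.add_apply, Pi.smul_apply, smul_eq_mul, add_mul,
    RCLike.star_def]

lemma g0_adjMatrix_mulVec_mul_addChar (χ : AddChar (Fin 8) ℂ) (y : Fin 8 → Fin 2 → ℂ) :
    g0.adjMatrix ℂ *ᵥ (fun v => y v.2.1 v.1 * χ (-v.2.2)) =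
      fun v => blochOperator χ y v.2.1 v.1 * χ (-v.2.2) := by
  ext ⟨z, t, j⟩
  have shift (k) : χ (-(j + k)) = conj (χ k) * χ (-j) := by
    rw [neg_add_rev, AddChar.map_add_eq_mul, AddChar.map_neg_eq_conj χ k]
  have shift' (k) : χ (-(j - k)) = χ k * χ (-j) := by
    rw [neg_sub, sub_eq_add_neg, AddChar.map_add_eq_mul]
  rw [g0_adjMatrix_mulVec]
  simp only [shift, shift', blochOperator, ← conj_add_conj_add_conj χ, hopMatrix, mulVec,
    dotProduct, conjTranspose_apply, of_apply, Pi.add_apply, Pi.smul_apply, smul_eq_mul, add_mul,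
    Finset.sum_mul, RCLike.star_def]
  congr 1
  · congr 1 <;> exact Finset.sum_congr rfl fun _ _ => by ring
  · ring

lemma mul_norm_le_of_blochOperator_eq_smul {χ : AddChar (Fin 8) ℂ} {y : Fin 8 → Fin 2 → ℂ} {μ : ℂ}
    (hy : blochOperator χ y = μ • y) : ‖μ - loopEigenvalue χ‖ * ‖y‖ ≤ 4 * ‖y‖ := by
  have hop (t s) : ‖hopMatrix χ t *ᵥ y s‖ ≤ 2 * ‖y‖ := by
    have := norm_mulVec_le_card_mul (A := hopMatrix χ t) (fun _ _ => (χ.norm_apply _).le) (y s)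
    rw [Fintype.card_fin, Nat.cast_ofNat] at this
    linarith [norm_le_pi_norm y s]
  have hop' (t s) : ‖(hopMatrix χ t)ᴴ *ᵥ y s‖ ≤ 2 * ‖y‖ := by
    have := norm_mulVec_le_card_mul (A := (hopMatrix χ t)ᴴ)
      (fun _ _ => (norm_star _).trans_le (χ.norm_apply _).le) (y s)
    rw [Fintype.card_fin, Nat.cast_ofNat] at this
    linarith [norm_le_pi_norm y s]
  rw [← norm_smul]
  refine (pi_norm_le_iff_of_nonneg (by positivity)).2 fun t => ?_
  have hop_eq : ((μ - loopEigenvalue χ) • y) t =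
      hopMatrix χ (t - 1) *ᵥ y (t - 1) + (hopMatrix χ t)ᴴ *ᵥ y (t + 1) := by
    rw [sub_smul, Pi.sub_apply, ← hy, blochOperator, Pi.smul_apply, add_sub_cancel_right]
  rw [hop_eq]
  linarith [norm_add_le (hopMatrix χ (t - 1) *ᵥ y (t - 1)) ((hopMatrix χ t)ᴴ *ᵥ y (t + 1)),
    hop (t - 1) (t - 1), hop' t (t + 1)]

lemma eq_zero_of_blochOperator_eq_smul {χ : AddChar (Fin 8) ℂ} (h : χ ≠ zetaChar)
    (h' : χ ≠ zetaChar⁻¹) {y : Fin 8 → Fin 2 → ℂ} {μ : ℝ} (hμ : μ ≤ e1)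
    (hy : blochOperator χ y = (μ : ℂ) • y) : y = 0 := by
  obtain ⟨c, hc, hχ⟩ := exists_loopEigenvalue_eq h h'
  have four_lt : 4 < ‖(μ : ℂ) - loopEigenvalue χ‖ := by
    have : 4 / 3 < √2 := Real.lt_sqrt_of_sq_lt (by norm_num)
    rw [hχ, ← Complex.ofReal_sub, Complex.norm_real, Real.norm_eq_abs, lt_abs]
    right
    unfold e1 at hμ
    linarith
  by_contra hne
  exact (mul_norm_le_of_blochOperator_eq_smul hy).not_gt
    (mul_lt_mul_of_pos_right four_lt (norm_pos_iff.2 hne))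

lemma hopMatrix_zetaChar (t : Fin 8) :
    hopMatrix zetaChar t = -(((√2 : ℝ) : ℂ) • (stepUnitary (t + 1) * (stepUnitary t)ᴴ)) := by
  ext x z
  exact zetaChar_hopExponent t x z

lemma blochOperator_zetaChar (w : Fin 8 → Fin 2 → ℂ) (t : Fin 8) :
    blochOperator zetaChar (fun t => stepUnitary t *ᵥ w t) t = stepUnitary t *ᵥ
      (-(√2 • (w (t - 1) + w (t + 1)) + (1 + √2) • w t)) := by
  have cancel (t s : Fin 8) : (stepUnitary t * (stepUnitary s)ᴴ) *ᵥ stepUnitary s *ᵥ w s =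
      stepUnitary t *ᵥ w s := by
    rw [mulVec_mulVec, Matrix.mul_assoc, ← star_eq_conjTranspose,
      mem_unitaryGroup_iff'.1 (stepUnitary_mem_unitaryGroup s), Matrix.mul_one]
  have hop : hopMatrix zetaChar (t - 1) *ᵥ stepUnitary (t - 1) *ᵥ w (t - 1) =
      -(((√2 : ℝ) : ℂ) • stepUnitary t *ᵥ w (t - 1)) := by
    rw [hopMatrix_zetaChar, sub_add_cancel, neg_mulVec, smul_mulVec, cancel]
  have hop' : (hopMatrix zetaChar t)ᴴ *ᵥ stepUnitary (t + 1) *ᵥ w (t + 1) =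
      -(((√2 : ℝ) : ℂ) • stepUnitary t *ᵥ w (t + 1)) := by
    rw [hopMatrix_zetaChar, conjTranspose_neg, conjTranspose_smul, conjTranspose_mul,
      conjTranspose_conjTranspose, neg_mulVec, smul_mulVec, cancel, RCLike.star_def,
      Complex.conj_ofReal]
  rw [blochOperator, hop, hop', loopEigenvalue_zetaChar]
  simp only [← Complex.coe_smul, mulVec_neg, mulVec_add, mulVec_smul]
  push_cast
  module

lemma exists_eq_stepUnitary_mulVec {y : Fin 8 → Fin 2 → ℂ} {μ : ℝ} (hμ : μ ≤ e1)
    (hy : blochOperator zetaChar y = (μ : ℂ) • y) : ∃ a, ∀ t, y t = stepUnitary t *ᵥ a := by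
  set w : Fin 8 → Fin 2 → ℂ := fun t => (stepUnitary t)ᴴ *ᵥ y t with hw
  have y_eq (t) : y t = stepUnitary t *ᵥ w t := by
    rw [hw, mulVec_mulVec, ← star_eq_conjTranspose,
      mem_unitaryGroup_iff.1 (stepUnitary_mem_unitaryGroup t), one_mulVec]
  have w_eq (t) : -(√2 • (w (t - 1) + w (t + 1)) + (1 + √2) • w t) = μ • w t := by
    have h := congrArg ((stepUnitary t)ᴴ *ᵥ ·) (congrFun hy t)
    rw [funext y_eq] at h
    simpa only [blochOperator_zetaChar, Pi.smul_apply, mulVec_smul, mulVec_mulVec,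
      ← star_eq_conjTranspose, mem_unitaryGroup_iff'.1 (stepUnitary_mem_unitaryGroup t),
      one_mulVec, Complex.coe_smul] using h
  have recurrence (z t) : (-(μ + 1 + √2) / √2) • w t z = w (t - 1) z + w (t + 1) z := by
    have h := congrFun (w_eq t) z
    simp only [Pi.neg_apply, Pi.add_apply, Pi.smul_apply] at h
    rw [div_eq_inv_mul, mul_smul, inv_smul_eq_iff₀ (by positivity)]
    simp only [neg_smul, add_smul, ← h, one_smul]
    abel
  have two_le : 2 ≤ -(μ + 1 + √2) / √2 := by
    rw [le_div_iff₀ (by positivity)]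
    unfold e1 at hμ
    linarith
  refine ⟨w 0, fun t => ?_⟩
  have w_const : w t = w 0 := by
    ext z
    simpa only [val_nsmul_one] using (periodic_of_smul_eq two_le (recurrence z)).nsmul_eq t
  rw [y_eq, w_const]

lemma g0_adjMatrix_mulVec_historyState (a : Fin 2 → ℂ) :
    g0.adjMatrix ℂ *ᵥ historyState a = (e1 : ℂ) • historyState a := by
  have historyState_eq : historyState a = ((1 / √8 : ℝ) : ℂ) •
      fun v => (stepUnitary v.2.1 *ᵥ a) v.1 * zetaChar (-v.2.2) := by
    ext v
    rw [historyState, omegaState_eq, Pi.smul_apply, smul_eq_mul, mul_left_comm]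
  have bloch_eq (t) : blochOperator zetaChar (fun t => stepUnitary t *ᵥ a) t =
      (e1 : ℂ) • stepUnitary t *ᵥ a := by
    rw [blochOperator_zetaChar fun _ => a, ← mulVec_smul, Complex.coe_smul, e1]
    congr 1
    module
  rw [historyState_eq, mulVec_smul,
    g0_adjMatrix_mulVec_mul_addChar zetaChar fun t => stepUnitary t *ᵥ a, smul_comm]
  congr 1
  ext v
  rw [bloch_eq, Pi.smul_apply, Pi.smul_apply, smul_mul_assoc]

lemma g0_adjMatrix_mulVec_of_mem_psiSpan {x : Vertex0 → ℂ} (hx : x ∈ psiSpan) :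
    g0.adjMatrix ℂ *ᵥ x = (e1 : ℂ) • x := by
  obtain ⟨a, b, rfl⟩ := mem_psiSpan_iff.1 hx
  rw [mulVec_add, adjMatrix_mulVec_star, g0_adjMatrix_mulVec_historyState,
    g0_adjMatrix_mulVec_historyState, star_smul, RCLike.star_def, Complex.conj_ofReal, smul_add]

lemma zetaChar_ne_inv : zetaChar ≠ zetaChar⁻¹ := by
  intro h
  have zeta_eq : zeta = conj zeta := by
    rw [← zetaChar_one, ← AddChar.map_neg_eq_conj, ← AddChar.inv_apply, ← h]
  exact zeta_sq_ne_one (by rw [sq, ← zeta_mul_conj_zeta, ← zeta_eq])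

lemma mem_psiSpan_of_g0_adjMatrix_mulVec_eq_smul {x : Vertex0 → ℂ} {μ : ℝ} (hμ : μ ≤ e1)
    (hx : g0.adjMatrix ℂ *ᵥ x = (μ : ℂ) • x) : x ∈ psiSpan := by
  have bloch_eq (χ) {x : Vertex0 → ℂ} (hx : g0.adjMatrix ℂ *ᵥ x = (μ : ℂ) • x) :
      blochOperator χ (fourierCoeff χ x) = (μ : ℂ) • fourierCoeff χ x := by
    rw [← fourierCoeff_g0_adjMatrix_mulVec, hx, fourierCoeff_smul]
  have hx_star : g0.adjMatrix ℂ *ᵥ star x = (μ : ℂ) • star x := by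
    rw [adjMatrix_mulVec_star, hx, star_smul, RCLike.star_def, Complex.conj_ofReal]
  obtain ⟨a, ha⟩ := exists_eq_stepUnitary_mulVec hμ (bloch_eq zetaChar hx)
  obtain ⟨b, hb⟩ := exists_eq_stepUnitary_mulVec hμ (bloch_eq zetaChar hx_star)
  have inversion (z t j) : 8 * x (z, t, j) = zetaChar (-j) * (stepUnitary t *ᵥ a) z +
      conj (zetaChar (-j) * (stepUnitary t *ᵥ b) z) := by
    rw [← sum_fourierCoeff, Finset.sum_eq_add zetaChar zetaChar⁻¹ zetaChar_ne_inv
      (fun χ _ hχ => by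
        rw [eq_zero_of_blochOperator_eq_smul hχ.1 hχ.2 hμ (bloch_eq χ hx)]; exact mul_zero _)
      (by simp) (by simp), fourierCoeff_inv, ha, Pi.star_apply, Pi.star_apply, hb, map_mul,
      AddChar.inv_apply, AddChar.map_neg_eq_conj _ (-j)]
    rfl
  refine mem_psiSpan_iff.2 ⟨((1 / √8 : ℝ) : ℂ) • a, ((1 / √8 : ℝ) : ℂ) • b, ?_⟩
  ext ⟨z, t, j⟩
  have sqrt_eight : ((1 / √8 : ℝ) : ℂ) * ((1 / √8 : ℝ) : ℂ) = 1 / 8 := by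
    rw [← Complex.ofReal_mul, ← sq, div_pow, Real.sq_sqrt (by norm_num)]
    norm_num
  simp only [historyState, mulVec_smul, omegaState_eq, Pi.add_apply, Pi.star_apply, Pi.smul_apply,
    smul_eq_mul, RCLike.star_def, map_mul, Complex.conj_ofReal]
  have h := inversion z t j
  rw [map_mul] at h
  linear_combination (1 / 8) * h - (zetaChar (-j) * (stepUnitary t *ᵥ a) z +
    conj (zetaChar (-j)) * conj ((stepUnitary t *ᵥ b) z)) * sqrt_eight

theorem hasG0Spectrum_g0 : HasG0Spectrum g0 := by
  have mem_psiSpan : psi 0 0 ∈ psiSpan := Submodule.subset_span ⟨(0, 0), rfl⟩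
  refine ⟨⟨?_, fun μ hμ => ?_⟩, ?_⟩
  · refine mem_eigenvalueSet_iff.2 ⟨psi 0 0, ?_, g0_adjMatrix_mulVec_of_mem_psiSpan mem_psiSpan⟩
    refine Function.ne_iff.2 ⟨(0, 1, 0), ?_⟩
    simp [psi, stepUnitary, omegaState]
  · obtain ⟨x, hx, hμx⟩ := mem_eigenvalueSet_iff.1 hμ
    rcases le_total e1 μ with h | h
    · exact h
    · have := g0_adjMatrix_mulVec_of_mem_psiSpan (mem_psiSpan_of_g0_adjMatrix_mulVec_eq_smul h hμx)
      exact_mod_cast (smul_left_injective ℂ hx (this.symm.trans hμx)).le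
  · ext x
    rw [Module.End.mem_eigenspace_iff, toLin'_apply]
    exact ⟨mem_psiSpan_of_g0_adjMatrix_mulVec_eq_smul le_rfl, g0_adjMatrix_mulVec_of_mem_psiSpan⟩

end GateGraph

theorem mainTheorem5_general :
    GateGraph.HasG0Spectrum GateGraph.g0 ∧
    ∃ C : ℝ, 0 < C ∧
      ∀ (g : SimpleGraph GateGraph.Vertex0) [DecidableRel g.Adj], GateGraph.HasG0Spectrum g →
      ∀ R : ℕ, 0 < R → ∀ D : GateGraph.GateDiagram R,
        ∃ γ γSL : ℝ,
          GateGraph.IsSmallestNonzeroEigenvalue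
            (D.adj g - (GateGraph.e1 : ℂ) • 1) γ ∧
          GateGraph.IsSmallestNonzeroEigenvalue
            (D.adjSL g - (GateGraph.e1 : ℂ) • 1) γSL ∧
          C * γ ≤ γSL :=
  ⟨GateGraph.hasG0Spectrum_g0, 1 / 37, by norm_num, fun _ _ hg _ hR _ =>
    GateGraph.GateDiagram.exists_isSmallestNonzeroEigenvalue_le_adjSL hg hR⟩

theorem mainTheorem5 :
    GateGraph.HasG0Spectrum GateGraph.g0 ∧
    ∃ C : ℝ, 0 < C ∧
      ∀ (g : SimpleGraph GateGraph.Vertex0) [DecidableRel g.Adj], GateGraph.HasG0Spectrum g →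
      ∀ (R : ℕ) (D : GateGraph.GateDiagram R), D.IsE1GateGraph g →
        ∃ γ γSL : ℝ,
          GateGraph.IsSmallestNonzeroEigenvalue
            (D.adj g - (GateGraph.e1 : ℂ) • 1) γ ∧
          GateGraph.IsSmallestNonzeroEigenvalue
            (D.adjSL g - (GateGraph.e1 : ℂ) • 1) γSL ∧
          C * γ ≤ γSL := by
  obtain ⟨hg0, C, hC, h⟩ := mainTheorem5_general
  exact ⟨hg0, C, hC, fun g _ hg R D hD => h g hg R hD.pos D⟩
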